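/- Let $E_0,E_1$ be complex Hilbert spaces, let $H_k=E_k\oplus E_k^*$ ($k=0,1$) with the antiunitary involution $f\mapsto f^*$ that exchanges $E_k$ and $E_k^*$ by the Riesz map, and let $H=H_0\oplus H_1$, with even part $H_0$ and odd part $H_1$. Let $P$ be the graded symmetrization on $H^{\otimes n}$ (for homogeneous vectors, the average over all permutations of the factors, with the sign of the induced permutation of the odd factors), let $S_n(H)$ be the closure of $P(H^{\otimes n})$, and let $S(H)=\bigoplus_n S_n(H)$ (Hilbert sum) be the Fock space, with product $F\odot G=\sqrt{\tfrac{(p+q)!}{p!\,q!}}\;P(F\otimes G)$ for $F\in S_p(H)$, $G\in S_q(H)$, with the antiunitary involution determined by $(f_1\otimes\dots\otimes f_n)^*=f_n^*\otimes\dots\otimes f_1^*$, and with the bilinear form $\langle F\,|\,G\rangle=(F^*\,|\,G)$, where $(\cdot|\cdot)$ is the inner product (antilinear in the first argument). Let $\Lambda$ be the Hilbert–Grassmann algebra generated by countably infinitely many anticommuting generators $\kappa_0,\kappa_1,\dots$, which are orthonormal and fixed by the involution: its elements are the sums $\lambda=\sum_A h(A)\kappa_A$ over the finite sets $A=\{a_1<\dots<a_n\}\subset\mathbb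 N$, $\kappa_A=\kappa_{a_1}\cdots\kappa_{a_n}$, with $\|\lambda\|^2=\sum_A(|A|!)^{-2}|h(A)|^2<\infty$; the involution of $\Lambda$ is antilinear and reverses products. Let $S^\Lambda(H)=\Lambda\mathbin{\widehat\otimes}S(H)$ (Hilbert tensor product), and extend the structure by continuity from $$(\lambda\otimes F)(\mu\otimes G)=\lambda\mu\otimes F\odot G,\quad (\lambda\otimes F)^*=\lambda^*\otimes F^*,\quad \langle\lambda\otimes F\,|\,\mu\otimes G\rangle=\lambda\mu\,\langle F\,|\,G\rangle,\quad (\Xi\,|\,\Theta)=\langle\Xi^*\,|\,\Theta\rangle ,$$ the last two with values in $\Lambda$; the product is used only between elements of fixed degrees in $S(H)$. Let $H_\Lambda=\Lambda_{\bar0}\mathbin{\widehat\otimes}H_0\oplus\Lambda_{\bar1}\mathbin{\widehat\otimes}H_1$ be the superspace, with $\Lambda_{\bar0}$, $\Lambda_{\bar1}$ the even and odd parts of $\Lambda$, and let $H_\Lambda^D=\{\zeta\in H_\Lambda:\zeta^*=\zeta\}$. For $\zeta\in H_\Lambda$ let $\exp\zeta=\sum_{p\ge0}\frac1{p!}\zeta^p\in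 S^\Lambda(H)$. For $\Xi\in S^\Lambda(H)$ let $$\varphi_\Xi(\zeta)=\langle\exp\zeta\,|\,\Xi\rangle\in\Lambda,\qquad\zeta\in H_\Lambda^D,$$ and let $\mathcal F^\Lambda(H_\Lambda^D)=\{\varphi_\Xi:\Xi\in S^\Lambda(H)\}$. Let $T$ be a bounded operator on $S(H)$, let $T'$ be its transpose, $T'F=(T^\dagger F^*)^*$, equivalently $\langle T'F\,|\,G\rangle=\langle F\,|\,TG\rangle$, and denote the $\Lambda$-linear extensions $\lambda\otimes F\mapsto\lambda\otimes TF$ and $\lambda\otimes F\mapsto\lambda\otimes T'F$ to $S^\Lambda(H)$ by the same letters. Then: 1. The $\Lambda$-valued form $\langle\varphi_\Xi\,\|\,\varphi_\Theta\rangle=\langle\Xi\,|\,\Theta\rangle$ and the operator $T_{\mathcal F}\,\varphi_\Xi=\varphi_{T\Xi}$ are well defined on $\mathcal F^\Lambda(H_\Lambda^D)$. 2. The kernel $K_T(\zeta_1,\zeta_2)=\langle T\exp\zeta_1\,|\,\exp\zeta_2\rangle$ satisfies, for all $\zeta_1,\zeta_2\in H_\Lambda^D$, $$K_T(\zeta_1,\zeta_2)=\langle\exp\zeta_1\,|\,T'\exp\zeta_2\rangle=(\exp\zeta_1\,|\,T'\exp\zeta_2).$$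 3. For every $\varphi\in\mathcal F^\Lambda(H_\Lambda^D)$ and every $\eta\in H_\Lambda^D$ the function $K_T(\cdot,\eta)$ belongs to $\mathcal F^\Lambda(H_\Lambda^D)$ and $$(T_{\mathcal F}\,\varphi)(\eta)=\langle K_T(\cdot,\eta)\,\|\,\varphi\rangle .$$ -/

import Mathlib

open scoped ComplexConjugate BigOperators Nat

noncomputable section

namespace SuperFock

/-! ## Componentwise operators on Hilbert sums -/

section lpMap

variable {I : Type*} {V W : I → Type*} [∀ i, NormedAddCommGroup (V i)]

theorem hasSum_sq (F : lp V 2) : HasSum (fun i => ‖F i‖ ^ 2) (‖F‖ ^ 2) := by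
  have h := lp.hasSum_norm (p := 2) (by norm_num) F
  simpa using h

theorem memlp_of_summable {f : ∀ i, V i} (h : Summable fun i => ‖f i‖ ^ 2) : Memℓp f 2 := by
  apply memℓp_gen
  simpa using h

theorem norm_le_of_sq_sum {C : ℝ} (hC : 0 ≤ C) (F : lp V 2)
    (h : ∑' i, ‖F i‖ ^ 2 ≤ C ^ 2) : ‖F‖ ≤ C := by
  rw [(hasSum_sq F).tsum_eq] at h
  exact le_of_sq_le_sq h hC

variable [∀ i, NormedSpace ℂ (V i)] [∀ i, NormedAddCommGroup (W i)]
  [∀ i, NormedSpace ℂ (W i)] {τ : ℂ →+* ℂ}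

theorem norm_single_le [DecidableEq I] (i : I) :
    ‖lp.singleContinuousLinearMap ℂ V 2 i‖ ≤ 1 :=
  ContinuousLinearMap.opNorm_le_bound _ zero_le_one (fun v => by
    rw [one_mul, lp.singleContinuousLinearMap_apply, lp.norm_single (by norm_num)])

theorem lpMap_mem (f : ∀ i, V i →SL[τ] W i) (C : ℝ)
    (hf : ∀ i v, ‖f i v‖ ≤ C * ‖v‖) (F : lp V 2) : Memℓp (fun i => f i (F i)) 2 := by
  apply memlp_of_summable
  refine Summable.of_nonneg_of_le (fun i => by positivity) (fun i => ?_)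
    ((hasSum_sq F).summable.mul_left (C ^ 2))
  rw [← mul_pow]
  exact pow_le_pow_left₀ (norm_nonneg _) (hf i _) 2

/-- The operator `(F_i) ↦ (f_i F_i)` between Hilbert sums, for uniformly bounded `f_i`. -/
def lpMap (f : ∀ i, V i →SL[τ] W i) (C : ℝ) (hC : 0 ≤ C)
    (hf : ∀ i v, ‖f i v‖ ≤ C * ‖v‖) : lp V 2 →SL[τ] lp W 2 :=
  LinearMap.mkContinuous
    { toFun := fun F => ⟨fun i => f i (F i), lpMap_mem f C hf F⟩
      map_add' := fun F G => by
        apply lp.ext; funext i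
        exact map_add (f i) (F i) (G i)
      map_smul' := fun c F => by
        apply lp.ext; funext i
        exact map_smulₛₗ (f i) c (F i) } C (fun F => by
      apply norm_le_of_sq_sum (by positivity)
      have h1 : Summable fun i => ‖f i (F i)‖ ^ 2 :=
        (hasSum_sq (V := W) ⟨_, lpMap_mem f C hf F⟩).summable
      have h2 := (hasSum_sq F).mul_left (C ^ 2)
      rw [mul_pow, ← h2.tsum_eq]
      refine h1.tsum_le_tsum (fun i => ?_) h2.summable
      rw [← mul_pow]
      exact pow_le_pow_left₀ (norm_nonneg _) (hf i _) 2)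

@[simp] theorem lpMap_apply (f : ∀ i, V i →SL[τ] W i) (C : ℝ) (hC : 0 ≤ C)
    (hf : ∀ i v, ‖f i v‖ ≤ C * ‖v‖) (F : lp V 2) (i : I) :
    lpMap f C hC hf F i = f i (F i) := rfl

end lpMap

/-! ## The Hilbert–Grassmann algebra `Λ` and `Λ`-extensions

`Λ` is generated by countably many anticommuting real generators `κ₀, κ₁, …`, orthonormal in the
generating Hilbert space.  For a finite set `A = {a₁ < … < aₙ}` put `κ_A = κ_{a₁} ⋯ κ_{aₙ}`.  The
norm is `‖∑ h(A) κ_A‖² = ∑ (|A|!)⁻² |h(A)|²`, so the vectors `e_A = |A|! κ_A` form an orthonormal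
basis, and `e_B e_C = ± (|B|! |C|! / (|B| + |C|)!) e_{B ∪ C}` for disjoint `B`, `C`.
The completed tensor product of `Λ` with a Hilbert space `V` consists of the sums `∑ e_A ⊗ v_A`
with norm `∑ ‖v_A‖²`. -/

section Extension

variable {V W X : Type*} [NormedAddCommGroup V] [NormedSpace ℂ V]
  [NormedAddCommGroup W] [NormedSpace ℂ W] [NormedAddCommGroup X] [NormedSpace ℂ X]

/-- The completed tensor product of `Λ` and `V`; the element `Ξ` stands for `∑_A e_A ⊗ Ξ A`. -/
abbrev LExt (V : Type*) [NormedAddCommGroup V] : Type _ := lp (fun _ : Finset ℕ => V) 2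

/-- The Hilbert–Grassmann algebra; the element `x` stands for `∑_A x A • e_A`. -/
abbrev Gr : Type := LExt ℂ

/-- The unit `κ_∅` of `Λ`. -/
def Gr.unit : Gr := lp.single 2 (∅ : Finset ℕ) (1 : ℂ)

/-- The decomposable tensor `x ⊗ v`. -/
def LExt.tmul (x : Gr) (v : V) : LExt V :=
  ⟨fun A => x A • v, memlp_of_summable (by
    simpa [norm_smul, mul_pow] using (hasSum_sq x).summable.mul_right (‖v‖ ^ 2))⟩

/-- `inversions B C` counts the pairs `b ∈ B`, `c ∈ C` with `c < b`. -/
def inversions (B C : Finset ℕ) : ℕ := ((B ×ˢ C).filter fun p => p.2 < p.1).card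

/-- The structure constant of `Λ`: `e_B e_C = mulCoeff B C • e_{B ∪ C}` for disjoint `B`, `C`. -/
def mulCoeff (B C : Finset ℕ) : ℝ :=
  (-1) ^ inversions B C * (((B.card)! * (C.card)! : ℝ) / ((B.card + C.card)! : ℝ))

theorem le_choose {n k : ℕ} (h1 : 1 ≤ k) (h2 : k + 1 ≤ n) : n ≤ n.choose k := by
  induction n generalizing k with
  | zero => omega
  | succ n ih =>
    obtain ⟨j, rfl⟩ : ∃ j, k = j + 1 := ⟨k - 1, by omega⟩
    rw [Nat.choose_succ_succ']
    rcases Nat.eq_or_lt_of_le h2 with h | h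
    · have hj : n = j + 1 := by omega
      subst hj
      simp
    · have h3 := ih (k := j + 1) (by omega) (by omega)
      have h4 : 0 < n.choose j := Nat.choose_pos (by omega)
      omega

theorem sum_inv_choose_le (n : ℕ) :
    ∑ k ∈ Finset.range (n + 1), ((n.choose k : ℝ))⁻¹ ≤ 3 := by
  rcases n with _ | n
  · norm_num
  · rw [Finset.sum_range_succ, Finset.sum_range_succ']
    have h : ∑ k ∈ Finset.range n, (((n + 1).choose (k + 1) : ℝ))⁻¹ ≤ 1 := by
      calc _ ≤ ∑ k ∈ Finset.range n, ((n + 1 : ℝ))⁻¹ := by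
            refine Finset.sum_le_sum fun k hk => ?_
            have hk' := Finset.mem_range.1 hk
            have := le_choose (n := n + 1) (k := k + 1) (by omega) (by omega)
            apply inv_anti₀ (by positivity)
            exact_mod_cast this
        _ = n * ((n + 1 : ℝ))⁻¹ := by simp
        _ ≤ 1 := by
            rw [← div_eq_mul_inv, div_le_one (by positivity)]
            linarith
    simp only [Nat.choose_zero_right, Nat.choose_self, Nat.cast_one, inv_one]
    linarith

theorem mulCoeff_sq {A B : Finset ℕ} (h : B ⊆ A) :
    mulCoeff B (A \ B) ^ 2 = (((A.card).choose B.card : ℝ))⁻¹ ^ 2 := by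
  have hc : (A \ B).card = A.card - B.card := Finset.card_sdiff_of_subset h
  have hle := Finset.card_le_card h
  rw [mulCoeff, mul_pow, ← pow_mul, mul_comm _ 2, pow_mul]
  norm_num
  rw [hc, Nat.add_sub_cancel' hle, Nat.cast_choose ℝ hle]
  field_simp

theorem sum_mulCoeff_sq_le (A : Finset ℕ) :
    ∑ B ∈ A.powerset, mulCoeff B (A \ B) ^ 2 ≤ 3 := by
  rw [Finset.sum_congr rfl (fun B hB => mulCoeff_sq (Finset.mem_powerset.1 hB)),
    Finset.sum_powerset_apply_card (fun k => (((A.card).choose k : ℝ))⁻¹ ^ 2)]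
  refine le_trans (le_of_eq ?_) (sum_inv_choose_le A.card)
  refine Finset.sum_congr rfl fun k hk => ?_
  have : 0 < (A.card).choose k := Nat.choose_pos (by simpa [Nat.lt_succ_iff] using hk)
  have h' : ((A.card).choose k : ℝ) ≠ 0 := by positivity
  rw [nsmul_eq_mul]
  field_simp

/-- The component of the `Λ`-bilinear extension of `β` at `e_A`. -/
def ext₂Fun (β : V →L[ℂ] W →L[ℂ] X) (Ξ : LExt V) (Θ : LExt W) (A : Finset ℕ) : X :=
  ∑ B ∈ A.powerset, (mulCoeff B (A \ B) : ℂ) • β (Ξ B) (Θ (A \ B))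

theorem norm_ext₂Fun_sq (β : V →L[ℂ] W →L[ℂ] X) (Ξ : LExt V) (Θ : LExt W) (A : Finset ℕ) :
    ‖ext₂Fun β Ξ Θ A‖ ^ 2 ≤
      3 * ‖β‖ ^ 2 * ∑ B ∈ A.powerset, ‖Ξ B‖ ^ 2 * ‖Θ (A \ B)‖ ^ 2 := by
  have h1 : ‖ext₂Fun β Ξ Θ A‖ ≤
      ∑ B ∈ A.powerset, |mulCoeff B (A \ B)| * (‖β‖ * (‖Ξ B‖ * ‖Θ (A \ B)‖)) := by
    refine (norm_sum_le _ _).trans (Finset.sum_le_sum fun B _ => ?_)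
    rw [norm_smul, Complex.norm_real, Real.norm_eq_abs, ← mul_assoc ‖β‖]
    exact mul_le_mul_of_nonneg_left (β.le_opNorm₂ _ _) (abs_nonneg _)
  calc ‖ext₂Fun β Ξ Θ A‖ ^ 2
      ≤ (∑ B ∈ A.powerset, |mulCoeff B (A \ B)| * (‖β‖ * (‖Ξ B‖ * ‖Θ (A \ B)‖))) ^ 2 :=
        pow_le_pow_left₀ (norm_nonneg _) h1 2
    _ ≤ (∑ B ∈ A.powerset, |mulCoeff B (A \ B)| ^ 2) *
          ∑ B ∈ A.powerset, (‖β‖ * (‖Ξ B‖ * ‖Θ (A \ B)‖)) ^ 2 :=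
        Finset.sum_mul_sq_le_sq_mul_sq _ _ _
    _ ≤ 3 * ∑ B ∈ A.powerset, (‖β‖ * (‖Ξ B‖ * ‖Θ (A \ B)‖)) ^ 2 := by
        refine mul_le_mul_of_nonneg_right ?_ (Finset.sum_nonneg fun _ _ => by positivity)
        simpa [sq_abs] using sum_mulCoeff_sq_le A
    _ = _ := by
        rw [Finset.mul_sum, Finset.mul_sum]
        refine Finset.sum_congr rfl fun B _ => ?_
        ring

theorem sum_ext₂Fun_sq (β : V →L[ℂ] W →L[ℂ] X) (Ξ : LExt V) (Θ : LExt W)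
    (s : Finset (Finset ℕ)) :
    ∑ A ∈ s, ‖ext₂Fun β Ξ Θ A‖ ^ 2 ≤ 3 * ‖β‖ ^ 2 * (‖Ξ‖ ^ 2 * ‖Θ‖ ^ 2) := by
  refine (Finset.sum_le_sum fun A _ => norm_ext₂Fun_sq β Ξ Θ A).trans ?_
  rw [← Finset.mul_sum]
  refine mul_le_mul_of_nonneg_left ?_ (by positivity)
  set t : Finset (Finset ℕ) := s.biUnion Finset.powerset with ht
  have h1 : ∑ A ∈ s, ∑ B ∈ A.powerset, ‖Ξ B‖ ^ 2 * ‖Θ (A \ B)‖ ^ 2 ≤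
      ∑ p ∈ t ×ˢ t, ‖Ξ p.1‖ ^ 2 * ‖Θ p.2‖ ^ 2 := by
    rw [Finset.sum_sigma' s (fun A : Finset ℕ => A.powerset)
      (fun (A B : Finset ℕ) => ‖Ξ B‖ ^ 2 * ‖Θ (A \ B)‖ ^ 2)]
    have hinj : Set.InjOn (fun q : (_ : Finset ℕ) × Finset ℕ => (q.2, q.1 \ q.2))
        ↑(s.sigma fun A => A.powerset) := by
      rintro ⟨A, B⟩ h ⟨A', B'⟩ h' hq
      simp only [Finset.coe_sigma, Set.mem_sigma_iff, Finset.mem_coe, Finset.mem_powerset] at h h'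
      simp only [Prod.mk.injEq] at hq
      obtain ⟨rfl, hq⟩ := hq
      have : A = A' := by
        rw [← Finset.union_sdiff_of_subset h.2, hq, Finset.union_sdiff_of_subset h'.2]
      subst this
      rfl
    rw [← Finset.sum_image (f := fun p : Finset ℕ × Finset ℕ => ‖Ξ p.1‖ ^ 2 * ‖Θ p.2‖ ^ 2) hinj]
    refine Finset.sum_le_sum_of_subset_of_nonneg ?_ (fun _ _ _ => by positivity)
    intro p hp
    obtain ⟨⟨A, B⟩, hq, rfl⟩ := Finset.mem_image.1 hp
    rw [Finset.mem_sigma] at hq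
    simp only [ht, Finset.mem_product, Finset.mem_biUnion]
    exact ⟨⟨A, hq.1, hq.2⟩, ⟨A, hq.1, by simp⟩⟩
  refine h1.trans ?_
  have h2 : ∑ p ∈ t ×ˢ t, ‖Ξ p.1‖ ^ 2 * ‖Θ p.2‖ ^ 2 =
      (∑ B ∈ t, ‖Ξ B‖ ^ 2) * ∑ C ∈ t, ‖Θ C‖ ^ 2 := by
    rw [Finset.sum_mul_sum]
    exact Finset.sum_product t t (fun p : Finset ℕ × Finset ℕ => ‖Ξ p.1‖ ^ 2 * ‖Θ p.2‖ ^ 2)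
  rw [h2]
  exact mul_le_mul (sum_le_hasSum t (fun _ _ => by positivity) (hasSum_sq Ξ))
    (sum_le_hasSum t (fun _ _ => by positivity) (hasSum_sq Θ))
    (Finset.sum_nonneg fun _ _ => by positivity) (by positivity)

theorem summable_ext₂Fun (β : V →L[ℂ] W →L[ℂ] X) (Ξ : LExt V) (Θ : LExt W) :
    Summable fun A => ‖ext₂Fun β Ξ Θ A‖ ^ 2 :=
  summable_of_sum_le (fun _ => by positivity) (sum_ext₂Fun_sq β Ξ Θ)

/-- The `Λ`-bilinear extension of a bounded bilinear map `β`: the continuous bilinear map with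
`(x ⊗ v, y ⊗ w) ↦ x y ⊗ β(v, w)`. -/
def ext₂ (β : V →L[ℂ] W →L[ℂ] X) : LExt V →L[ℂ] LExt W →L[ℂ] LExt X :=
  LinearMap.mkContinuous₂
    (LinearMap.mk₂ ℂ
      (fun Ξ Θ => (⟨ext₂Fun β Ξ Θ, memlp_of_summable (summable_ext₂Fun β Ξ Θ)⟩ : LExt X))
      (fun Ξ Ξ' Θ => by
        apply lp.ext; funext A
        change ext₂Fun β _ _ A = ext₂Fun β _ _ A + ext₂Fun β _ _ A
        simp [ext₂Fun, Finset.sum_add_distrib])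
      (fun c Ξ Θ => by
        apply lp.ext; funext A
        simp [ext₂Fun, Finset.smul_sum, smul_comm c])
      (fun Ξ Θ Θ' => by
        apply lp.ext; funext A
        change ext₂Fun β _ _ A = ext₂Fun β _ _ A + ext₂Fun β _ _ A
        simp [ext₂Fun, Finset.sum_add_distrib])
      (fun c Ξ Θ => by
        apply lp.ext; funext A
        simp [ext₂Fun, Finset.smul_sum, smul_comm c]))
    (√3 * ‖β‖) (fun Ξ Θ => by
      apply norm_le_of_sq_sum (by positivity)
      refine (summable_ext₂Fun β Ξ Θ).tsum_le_of_sum_le fun s => ?_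
      refine (sum_ext₂Fun_sq β Ξ Θ s).trans (le_of_eq ?_)
      rw [mul_pow, mul_pow, mul_pow, Real.sq_sqrt (by norm_num)]
      ring)

theorem ext₂_apply (β : V →L[ℂ] W →L[ℂ] X) (Ξ : LExt V) (Θ : LExt W) (A : Finset ℕ) :
    ext₂ β Ξ Θ A = ∑ B ∈ A.powerset, (mulCoeff B (A \ B) : ℂ) • β (Ξ B) (Θ (A \ B)) := rfl

theorem norm_ext₂_le (β : V →L[ℂ] W →L[ℂ] X) : ‖ext₂ β‖ ≤ √3 * ‖β‖ :=
  LinearMap.mkContinuous₂_norm_le _ (by positivity) _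

/-- The product of `Λ`. -/
def Gr.mul : Gr →L[ℂ] Gr →L[ℂ] Gr := ext₂ (ContinuousLinearMap.mul ℂ ℂ)

theorem ext₂_tmul (β : V →L[ℂ] W →L[ℂ] X) (x y : Gr) (v : V) (w : W) :
    ext₂ β (LExt.tmul x v) (LExt.tmul y w) = LExt.tmul (Gr.mul x y) (β v w) := by
  apply lp.ext; funext A
  simp [ext₂_apply, LExt.tmul, Gr.mul, Finset.sum_smul, smul_smul, mul_comm]

/-- The `Λ`-linear extension of a bounded operator. -/
def LExt.map (T : V →L[ℂ] W) : LExt V →L[ℂ] LExt W :=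
  lpMap (fun _ => T) ‖T‖ (norm_nonneg _) (fun _ v => T.le_opNorm v)

theorem LExt.norm_map_le (T : V →L[ℂ] W) : ‖LExt.map T‖ ≤ ‖T‖ := by
  unfold LExt.map lpMap
  exact LinearMap.mkContinuous_norm_le _ (norm_nonneg _) _

theorem LExt.norm_map_apply_le (T : V →L[ℂ] W) (hT : ‖T‖ ≤ 1) (Ξ : LExt V) :
    ‖LExt.map T Ξ‖ ≤ ‖Ξ‖ := by
  have h := (LExt.map T).le_of_opNorm_le ((LExt.norm_map_le T).trans hT) Ξ
  rwa [one_mul] at h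

theorem LExt.map_tmul (T : V →L[ℂ] W) (x : Gr) (v : V) :
    LExt.map T (LExt.tmul x v) = LExt.tmul x (T v) := by
  apply lp.ext; funext A
  simp [LExt.map, LExt.tmul]

/-- The involution of `Λ ⊗ V` with `(x ⊗ v)* = x* ⊗ v*`, for an antilinear `v ↦ v*` on `V`.  The
involution of `Λ` is antilinear, reverses products and fixes the generators, so that
`e_A* = (-1)^{n(n-1)/2} e_A` with `n = |A|`. -/
def LExt.star (s : V →L⋆[ℂ] V) : LExt V →L⋆[ℂ] LExt V :=
  lpMap (fun A => ((-1 : ℂ) ^ (A.card).choose 2) • s) ‖s‖ (norm_nonneg _)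
    (fun A v => by
      rw [smul_apply, norm_smul]
      simpa using s.le_opNorm v)

end Extension

/-! ## The graded one-particle Hilbert space -/

section OneParticle

variable (E₀ E₁ : Type*) [NormedAddCommGroup E₀] [InnerProductSpace ℂ E₀] [CompleteSpace E₀]
  [NormedAddCommGroup E₁] [InnerProductSpace ℂ E₁] [CompleteSpace E₁]

/-- The Hilbert space `E ⊕ E*`. -/
abbrev Doubled (E : Type*) [NormedAddCommGroup E] [InnerProductSpace ℂ E] : Type _ :=
  WithLp 2 (E × StrongDual ℂ E)

/-- The graded Hilbert space `H = H₀ ⊕ H₁` with even part `H₀ = E₀ ⊕ E₀*` (bosons) and odd part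
`H₁ = E₁ ⊕ E₁*` (fermions). -/
abbrev OneP : Type _ := WithLp 2 (Doubled E₀ × Doubled E₁)

/-- The antiunitary involution of `E ⊕ E*`, which exchanges `E` and `E*` by the Riesz map. -/
def Doubled.star (E : Type*) [NormedAddCommGroup E] [InnerProductSpace ℂ E] [CompleteSpace E] :
    Doubled E →L⋆[ℂ] Doubled E :=
  LinearMap.mkContinuous
    { toFun := fun f => WithLp.toLp 2
        ((InnerProductSpace.toDual ℂ E).symm f.snd, InnerProductSpace.toDual ℂ E f.fst)
      map_add' := fun f g => by
        apply (WithLp.equiv 2 _).injective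
        simp
      map_smul' := fun c f => by
        apply (WithLp.equiv 2 _).injective
        simp [map_smulₛₗ] } 1 (fun f => by
      simp [WithLp.prod_norm_eq_of_L2, add_comm])

theorem Doubled.norm_star (E : Type*) [NormedAddCommGroup E] [InnerProductSpace ℂ E]
    [CompleteSpace E] (f : Doubled E) : ‖Doubled.star E f‖ = ‖f‖ := by
  simp [Doubled.star, WithLp.prod_norm_eq_of_L2, add_comm]

/-- The antiunitary involution of `H`. -/
def OneP.star : OneP E₀ E₁ →L⋆[ℂ] OneP E₀ E₁ :=
  LinearMap.mkContinuous
    { toFun := fun f => WithLp.toLp 2 (Doubled.star E₀ f.fst, Doubled.star E₁ f.snd)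
      map_add' := fun f g => by
        apply (WithLp.equiv 2 _).injective
        simp
      map_smul' := fun c f => by
        apply (WithLp.equiv 2 _).injective
        simp } 1 (fun f => by
      rw [one_mul, WithLp.prod_norm_eq_of_L2 f]
      refine le_of_eq ((WithLp.prod_norm_eq_of_L2 (α := Doubled E₀) (β := Doubled E₁) _).trans ?_)
      change √(‖Doubled.star E₀ f.fst‖ ^ 2 + ‖Doubled.star E₁ f.snd‖ ^ 2) = _
      rw [Doubled.norm_star, Doubled.norm_star])

end OneParticle

/-! ## Tensor powers of `H` -/

section Tensor

/-- The index set of a chosen orthonormal basis of `E`. -/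
def BasisIndex (E : Type*) [NormedAddCommGroup E] [InnerProductSpace ℂ E] [CompleteSpace E] :
    Type _ :=
  ↥(Classical.choose (exists_hilbertBasis ℂ E))

/-- The chosen orthonormal basis of `E`. -/
def onb (E : Type*) [NormedAddCommGroup E] [InnerProductSpace ℂ E] [CompleteSpace E] :
    HilbertBasis (BasisIndex E) ℂ E :=
  Classical.choose (Classical.choose_spec (exists_hilbertBasis ℂ E))

variable (E₀ E₁ : Type*) [NormedAddCommGroup E₀] [InnerProductSpace ℂ E₀] [CompleteSpace E₀]
  [NormedAddCommGroup E₁] [InnerProductSpace ℂ E₁] [CompleteSpace E₁]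

/-- The index set of an orthonormal basis of `H` of homogeneous vectors: with `b` the chosen basis
of `E₀` or `E₁`, the index `(i, false)` stands for `b i` and `(i, true)` for its conjugate
`(b i)*`; the left summand belongs to `H₀` and the right one to `H₁`. -/
abbrev Mode : Type _ := (BasisIndex E₀ × Bool) ⊕ (BasisIndex E₁ × Bool)

variable {E₀ E₁}

/-- The fermionic indices. -/
def Mode.isOdd (m : Mode E₀ E₁) : Bool := m.isRight

/-- The conjugate of the basis vector `m` is the basis vector `m.bar`. -/
def Mode.bar (m : Mode E₀ E₁) : Mode E₀ E₁ :=
  m.map (Prod.map id not) (Prod.map id not)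

@[simp] theorem Mode.bar_bar (m : Mode E₀ E₁) : m.bar.bar = m := by
  rcases m with ⟨i, b⟩ | ⟨i, b⟩ <;> simp [Mode.bar]

@[simp] theorem Mode.isOdd_bar (m : Mode E₀ E₁) : m.bar.isOdd = m.isOdd := by
  rcases m with ⟨i, b⟩ | ⟨i, b⟩ <;> simp [Mode.bar, Mode.isOdd]

/-- The coordinates of a vector of `E ⊕ E*`. -/
def Doubled.coord {E : Type*} [NormedAddCommGroup E] [InnerProductSpace ℂ E] [CompleteSpace E]
    (f : Doubled E) : BasisIndex E × Bool → ℂ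
  | (i, false) => inner ℂ (onb E i) f.fst
  | (i, true) => f.snd (onb E i)

/-- The coordinate of a vector of `H` with respect to the basis vector `m`. -/
def OneP.coord (f : OneP E₀ E₁) : Mode E₀ E₁ → ℂ
  | .inl k => Doubled.coord f.fst k
  | .inr k => Doubled.coord f.snd k

theorem hasSum_onb {E : Type*} [NormedAddCommGroup E] [InnerProductSpace ℂ E] [CompleteSpace E]
    (u : E) : HasSum (fun i => ‖inner ℂ (onb E i) u‖ ^ 2) (‖u‖ ^ 2) := by
  have h := hasSum_sq ((onb E).repr u)
  simpa [HilbertBasis.repr_apply_apply] using h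

theorem Doubled.hasSum_coord {E : Type*} [NormedAddCommGroup E] [InnerProductSpace ℂ E]
    [CompleteSpace E] (f : Doubled E) : HasSum (fun k => ‖f.coord k‖ ^ 2) (‖f‖ ^ 2) := by
  have h1 := hasSum_onb f.fst
  have h2 := hasSum_onb ((InnerProductSpace.toDual ℂ E).symm f.snd)
  have h3 : ∀ i, ‖inner ℂ (onb E i) ((InnerProductSpace.toDual ℂ E).symm f.snd)‖ =
      ‖f.snd (onb E i)‖ := fun i => by
    rw [norm_inner_symm, InnerProductSpace.toDual_symm_apply]
  simp only [h3, LinearIsometryEquiv.norm_map] at h2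
  have h4 : HasSum (fun k : BasisIndex E ⊕ BasisIndex E =>
      ‖f.coord (((Equiv.prodComm _ _).trans (Equiv.boolProdEquivSum _)).symm k)‖ ^ 2)
      (‖f.fst‖ ^ 2 + ‖f.snd‖ ^ 2) := HasSum.sum h1 h2
  rw [WithLp.prod_norm_sq_eq_of_L2]
  exact (Equiv.hasSum_iff (f := fun k => ‖f.coord k‖ ^ 2) _).1 h4

theorem OneP.hasSum_coord (f : OneP E₀ E₁) : HasSum (fun m => ‖f.coord m‖ ^ 2) (‖f‖ ^ 2) := by
  rw [WithLp.prod_norm_sq_eq_of_L2]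
  exact HasSum.sum (Doubled.hasSum_coord f.fst) (Doubled.hasSum_coord f.snd)

variable (E₀ E₁) in
/-- The completed tensor power of `n` copies of `H`, in coordinates: `F` stands for
`∑_a F a • e_{a 0} ⊗ ⋯ ⊗ e_{a (n-1)}`, where `e_m` is the orthonormal basis of `H` above. -/
abbrev Tens (n : ℕ) : Type _ := lp (fun _ : Fin n → Mode E₀ E₁ => ℂ) 2

/-- The unit of the tensor algebra. -/
def Tens.one : Tens E₀ E₁ 0 := lp.single 2 (fun i => i.elim0) (1 : ℂ)

theorem hasSum_sq_comp {K : Type*} (e : K ≃ K) (F : lp (fun _ : K => ℂ) 2) :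
    HasSum (fun k => ‖F (e k)‖ ^ 2) (‖F‖ ^ 2) :=
  (Equiv.hasSum_iff (f := fun k => ‖F k‖ ^ 2) e).2 (hasSum_sq F)

variable {n : ℕ}

/-- The embedding of `H` as tensors of degree one. -/
def Tens.ofOneP : OneP E₀ E₁ →L[ℂ] Tens E₀ E₁ 1 :=
  have h : ∀ f : OneP E₀ E₁,
      HasSum (fun a : Fin 1 → Mode E₀ E₁ => ‖f.coord (a 0)‖ ^ 2) (‖f‖ ^ 2) := fun f =>
    (Equiv.hasSum_iff (f := fun m => ‖f.coord m‖ ^ 2)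
      (Equiv.funUnique (Fin 1) (Mode E₀ E₁))).2 f.hasSum_coord
  LinearMap.mkContinuous
    { toFun := fun f => ⟨fun a => f.coord (a 0), memlp_of_summable (h f).summable⟩
      map_add' := fun f g => by
        apply lp.ext; funext a
        change (f + g).coord (a 0) = f.coord (a 0) + g.coord (a 0)
        rcases a 0 with ⟨i, _ | _⟩ | ⟨i, _ | _⟩ <;>
          simp [OneP.coord, Doubled.coord]
      map_smul' := fun c f => by
        apply lp.ext; funext a
        change (c • f).coord (a 0) = c • f.coord (a 0)
        rcases a 0 with ⟨i, _ | _⟩ | ⟨i, _ | _⟩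
        · exact inner_smul_right _ _ _
        · rfl
        · exact inner_smul_right _ _ _
        · rfl } 1 (fun f => by
      apply norm_le_of_sq_sum (by positivity)
      rw [one_mul, ← (h f).tsum_eq]
      rfl)

/-- The sign `χ_σ(a) = ± 1`, the parity of the number of inversions among the fermionic entries
of the permuted sequence `a (σ 0), …, a (σ (n-1))`. -/
def sgn (σ : Equiv.Perm (Fin n)) (a : Fin n → Mode E₀ E₁) : ℂ :=
  (-1) ^ (Finset.univ.filter fun p : Fin n × Fin n =>
    p.1 < p.2 ∧ σ p.2 < σ p.1 ∧ (a (σ p.1)).isOdd ∧ (a (σ p.2)).isOdd).card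

@[simp] theorem norm_sgn (σ : Equiv.Perm (Fin n)) (a : Fin n → Mode E₀ E₁) : ‖sgn σ a‖ = 1 := by
  simp [sgn]

/-- The operator `F ↦ (a ↦ χ_σ(a) F(a ∘ σ))`. -/
def permOp (σ : Equiv.Perm (Fin n)) : Tens E₀ E₁ n →L[ℂ] Tens E₀ E₁ n :=
  have h : ∀ F : Tens E₀ E₁ n,
      HasSum (fun a : Fin n → Mode E₀ E₁ => ‖sgn σ a * F (a ∘ σ)‖ ^ 2) (‖F‖ ^ 2) := fun F => by
    have h1 := hasSum_sq_comp (Equiv.arrowCongr σ.symm (Equiv.refl _)) F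
    simp only [norm_mul, norm_sgn, one_mul]
    exact h1
  LinearMap.mkContinuous
    { toFun := fun F => ⟨fun a => sgn σ a * F (a ∘ σ), memlp_of_summable (h F).summable⟩
      map_add' := fun F G => by
        apply lp.ext; funext a
        exact mul_add _ _ _
      map_smul' := fun c F => by
        apply lp.ext; funext a
        exact mul_left_comm _ _ _ } 1 (fun F => by
      apply norm_le_of_sq_sum (by positivity)
      rw [one_mul, ← (h F).tsum_eq]
      rfl)

@[simp] theorem permOp_apply (σ : Equiv.Perm (Fin n)) (F : Tens E₀ E₁ n)
    (a : Fin n → Mode E₀ E₁) : permOp σ F a = sgn σ a * F (a ∘ σ) := rfl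

variable (E₀ E₁ n) in
/-- The graded symmetrization
`P (f₁ ⊗ ⋯ ⊗ fₙ) = (n!)⁻¹ ∑_σ χ_σ(f) f_{σ 1} ⊗ ⋯ ⊗ f_{σ n}` for homogeneous `f_i`. -/
def symm : Tens E₀ E₁ n →L[ℂ] Tens E₀ E₁ n :=
  ((n ! : ℂ)⁻¹) • ∑ σ : Equiv.Perm (Fin n), permOp σ

theorem symm_apply (F : Tens E₀ E₁ n) (a : Fin n → Mode E₀ E₁) :
    symm E₀ E₁ n F a = ((n ! : ℂ)⁻¹) * ∑ σ : Equiv.Perm (Fin n), sgn σ a * F (a ∘ σ) := by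
  rw [symm, smul_apply, sum_apply, lp.coeFn_smul, Pi.smul_apply,
    lp.coeFn_sum, Finset.sum_apply, smul_eq_mul]
  rfl

theorem sgn_comp_inv (σ : Equiv.Perm (Fin n)) (a : Fin n → Mode E₀ E₁) :
    sgn σ⁻¹ (a ∘ σ) = sgn σ a := by
  unfold sgn
  congr 1
  refine Finset.card_bij' (fun p _ => (σ⁻¹ p.2, σ⁻¹ p.1)) (fun p _ => (σ p.2, σ p.1)) ?_ ?_ ?_ ?_
  · rintro ⟨i, j⟩ h
    simp at h ⊢
    tauto
  · rintro ⟨i, j⟩ h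
    simp at h ⊢
    tauto
  · rintro ⟨i, j⟩ h
    simp
  · rintro ⟨i, j⟩ h
    simp

theorem norm_permOp_le (σ : Equiv.Perm (Fin n)) :
    ‖(permOp σ : Tens E₀ E₁ n →L[ℂ] Tens E₀ E₁ n)‖ ≤ 1 := by
  unfold permOp
  exact LinearMap.mkContinuous_norm_le _ zero_le_one _

theorem norm_symm_le : ‖symm E₀ E₁ n‖ ≤ 1 := by
  rw [symm, norm_smul, norm_inv, Complex.norm_natCast, inv_mul_le_iff₀ (by positivity), mul_one]
  refine (norm_sum_le _ _).trans ((Finset.sum_le_sum fun σ _ => norm_permOp_le σ).trans ?_)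
  simp [Fintype.card_perm]

/-- The values of the symmetrization on the basis vectors of the tensor power. -/
theorem symm_single [DecidableEq (Mode E₀ E₁)] (a : Fin n → Mode E₀ E₁) :
    symm E₀ E₁ n (lp.single 2 a (1 : ℂ)) =
      ((n ! : ℂ)⁻¹) • ∑ σ : Equiv.Perm (Fin n), sgn σ a • lp.single 2 (a ∘ σ) (1 : ℂ) := by
  apply lp.ext; funext b
  rw [symm_apply, lp.coeFn_smul, Pi.smul_apply, lp.coeFn_sum, Finset.sum_apply, smul_eq_mul]
  congr 1
  rw [← Equiv.sum_comp (Equiv.inv (Equiv.Perm (Fin n)))]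
  refine Finset.sum_congr rfl fun σ _ => ?_
  rw [lp.coeFn_smul, Pi.smul_apply, smul_eq_mul, lp.single_apply, lp.single_apply]
  by_cases h : b = a ∘ σ
  · subst h
    have e : (a ∘ σ) ∘ ((Equiv.inv (Equiv.Perm (Fin n))) σ) = a := by
      funext i; simp
    rw [e, Pi.single_eq_same, Pi.single_eq_same]
    rw [← sgn_comp_inv σ a]
    rfl
  · have h' : b ∘ ((Equiv.inv (Equiv.Perm (Fin n))) σ) ≠ a := by
      intro hb
      apply h
      rw [← hb]
      funext i; simp
    rw [Pi.single_eq_of_ne h', Pi.single_eq_of_ne h]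
    simp

variable (E₀ E₁) in
/-- The tensor product of homogeneous tensors. -/
def tensMul (p q : ℕ) : Tens E₀ E₁ p →L[ℂ] Tens E₀ E₁ q →L[ℂ] Tens E₀ E₁ (p + q) :=
  have h : ∀ (F : Tens E₀ E₁ p) (G : Tens E₀ E₁ q),
      HasSum (fun a : Fin (p + q) → Mode E₀ E₁ =>
        ‖F (fun i => a (Fin.castAdd q i)) * G (fun j => a (Fin.natAdd p j))‖ ^ 2)
        (‖F‖ ^ 2 * ‖G‖ ^ 2) := fun F G => by
    have hF := hasSum_sq F
    have hG := hasSum_sq G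
    have h1 := hF.mul hG (hF.summable.mul_of_nonneg hG.summable
      (fun _ => by positivity) (fun _ => by positivity))
    have h2 := (Equiv.hasSum_iff (Fin.appendEquiv (α := Mode E₀ E₁) p q).symm).2 h1
    simpa [Function.comp_def, mul_pow] using h2
  LinearMap.mkContinuous₂
    (LinearMap.mk₂ ℂ
      (fun F G => (⟨fun a => F (fun i => a (Fin.castAdd q i)) * G (fun j => a (Fin.natAdd p j)),
        memlp_of_summable (h F G).summable⟩ : Tens E₀ E₁ (p + q)))
      (fun F F' G => by
        apply lp.ext; funext a
        exact add_mul _ _ _)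
      (fun c F G => by
        apply lp.ext; funext a
        exact mul_assoc _ _ _)
      (fun F G G' => by
        apply lp.ext; funext a
        exact mul_add _ _ _)
      (fun c F G => by
        apply lp.ext; funext a
        exact mul_left_comm _ _ _))
    1 (fun F G => by
      apply norm_le_of_sq_sum (by positivity)
      rw [one_mul, mul_pow, ← (h F G).tsum_eq]
      rfl)

@[simp] theorem tensMul_apply (p q : ℕ) (F : Tens E₀ E₁ p) (G : Tens E₀ E₁ q)
    (a : Fin (p + q) → Mode E₀ E₁) : tensMul E₀ E₁ p q F G a =
      F (fun i => a (Fin.castAdd q i)) * G (fun j => a (Fin.natAdd p j)) := rfl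

theorem norm_tensMul_le (p q : ℕ) (F : Tens E₀ E₁ p) (G : Tens E₀ E₁ q) :
    ‖tensMul E₀ E₁ p q F G‖ ≤ ‖F‖ * ‖G‖ := by
  have h : ‖tensMul E₀ E₁ p q‖ ≤ 1 := by
    unfold tensMul
    exact LinearMap.mkContinuous₂_norm_le _ zero_le_one _
  simpa using (tensMul E₀ E₁ p q).le_of_opNorm₂_le_of_le h le_rfl le_rfl

/-- The antiunitary involution `(f₁ ⊗ ⋯ ⊗ fₙ)* = fₙ* ⊗ ⋯ ⊗ f₁*`. -/
def Tens.star : Tens E₀ E₁ n →L⋆[ℂ] Tens E₀ E₁ n :=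
  have h : ∀ F : Tens E₀ E₁ n,
      HasSum (fun a : Fin n → Mode E₀ E₁ => ‖conj (F (fun i => (a i.rev).bar))‖ ^ 2)
        (‖F‖ ^ 2) := fun F => by
    have h1 := hasSum_sq_comp (Equiv.arrowCongr (Fin.revPerm (n := n))
      (Function.Involutive.toPerm Mode.bar (Mode.bar_bar (E₀ := E₀) (E₁ := E₁)))) F
    simp only [RCLike.norm_conj]
    exact h1
  LinearMap.mkContinuous
    { toFun := fun F => ⟨fun a => starRingEnd ℂ (F (fun i => (a i.rev).bar)),
        memlp_of_summable (h F).summable⟩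
      map_add' := fun F G => by
        apply lp.ext; funext a
        exact map_add (starRingEnd ℂ) _ _
      map_smul' := fun c F => by
        apply lp.ext; funext a
        exact map_mul (starRingEnd ℂ) _ _ } 1 (fun F => by
      apply norm_le_of_sq_sum (by positivity)
      rw [one_mul, ← (h F).tsum_eq]
      rfl)

@[simp] theorem Tens.star_apply (F : Tens E₀ E₁ n) (a : Fin n → Mode E₀ E₁) :
    Tens.star F a = conj (F (fun i => (a i.rev).bar)) := rfl

theorem Tens.norm_star_le (F : Tens E₀ E₁ n) : ‖Tens.star F‖ ≤ ‖F‖ := by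
  have h : ‖(Tens.star : Tens E₀ E₁ n →L⋆[ℂ] Tens E₀ E₁ n)‖ ≤ 1 := by
    unfold Tens.star
    exact LinearMap.mkContinuous_norm_le _ zero_le_one _
  simpa using (Tens.star : Tens E₀ E₁ n →L⋆[ℂ] Tens E₀ E₁ n).le_of_opNorm_le h F

/-- The involution of degree one tensors is the involution of `H`. -/
theorem Tens.star_ofOneP (f : OneP E₀ E₁) :
    Tens.star (Tens.ofOneP f) = Tens.ofOneP (OneP.star E₀ E₁ f) := by
  apply lp.ext; funext a
  change conj (f.coord (a (Fin.rev 0)).bar) = (OneP.star E₀ E₁ f).coord (a 0)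
  rw [show Fin.rev (0 : Fin 1) = 0 from rfl]
  rcases a 0 with ⟨i, _ | _⟩ | ⟨i, _ | _⟩ <;>
    simp [OneP.coord, Doubled.coord, Mode.bar, OneP.star, Doubled.star,
      ← InnerProductSpace.toDual_symm_apply]

theorem sgn_rev (σ : Equiv.Perm (Fin n)) (a : Fin n → Mode E₀ E₁) :
    sgn σ (fun i => (a i.rev).bar) = sgn (Fin.revPerm * σ * Fin.revPerm) a := by
  unfold sgn
  congr 1
  refine Finset.card_bij' (fun p _ => (p.2.rev, p.1.rev)) (fun p _ => (p.2.rev, p.1.rev))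
    ?_ ?_ ?_ ?_
  · rintro ⟨i, j⟩ h
    simp at h ⊢
    tauto
  · rintro ⟨i, j⟩ h
    simp at h ⊢
    tauto
  · rintro ⟨i, j⟩ h
    simp
  · rintro ⟨i, j⟩ h
    simp

theorem symm_star (F : Tens E₀ E₁ n) :
    symm E₀ E₁ n (Tens.star F) = Tens.star (symm E₀ E₁ n F) := by
  apply lp.ext; funext a
  rw [Tens.star_apply, symm_apply, symm_apply, map_mul, map_sum]
  congr 1
  · simp
  · rw [← Equiv.sum_comp ((Equiv.mulLeft (Fin.revPerm (n := n))).trans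
      (Equiv.mulRight (Fin.revPerm (n := n))))]
    refine Finset.sum_congr rfl fun σ _ => ?_
    rw [map_mul, sgn_rev, Tens.star_apply]
    congr 1
    · simp [sgn]
    · simp [Function.comp_def]

end Tensor

/-! ## The Fock space -/

section Fock

variable (E₀ E₁ : Type*) [NormedAddCommGroup E₀] [InnerProductSpace ℂ E₀] [CompleteSpace E₀]
  [NormedAddCommGroup E₁] [InnerProductSpace ℂ E₁] [CompleteSpace E₁]

/-- The space `S_n(H)` of graded symmetric tensors of degree `n`: the completion of the image of
the graded symmetrization. -/
def symTens (n : ℕ) : Submodule ℂ (Tens E₀ E₁ n) :=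
  (LinearMap.range (symm E₀ E₁ n).toLinearMap).topologicalClosure

instance symTens.normedAddCommGroup (n : ℕ) : NormedAddCommGroup (symTens E₀ E₁ n) :=
  Submodule.normedAddCommGroup _

instance symTens.innerProductSpace (n : ℕ) : InnerProductSpace ℂ (symTens E₀ E₁ n) :=
  Submodule.innerProductSpace _

instance symTens.normedSpace (n : ℕ) : NormedSpace ℂ (symTens E₀ E₁ n) :=
  Submodule.normedSpace _

instance symTens.completeSpace (n : ℕ) : CompleteSpace (symTens E₀ E₁ n) :=
  Submodule.topologicalClosure.completeSpace _

variable {E₀ E₁} in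
theorem symm_mem {n : ℕ} (F : Tens E₀ E₁ n) : symm E₀ E₁ n F ∈ symTens E₀ E₁ n :=
  Submodule.le_topologicalClosure _ ⟨F, rfl⟩

/-- The unit of the superalgebra. -/
def symOne : symTens E₀ E₁ 0 :=
  ⟨Tens.one, by
    have h : symm E₀ E₁ 0 Tens.one = Tens.one := by
      apply lp.ext; funext a
      rw [symm_apply]
      have ha : ∀ σ : Equiv.Perm (Fin 0), a ∘ σ = a := fun σ => Subsingleton.elim _ _
      simp [ha, sgn]
    rw [← h]
    exact symm_mem _⟩

/-- The embedding of `H` onto the tensors of degree one. -/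
def symOfOneP : OneP E₀ E₁ →L[ℂ] symTens E₀ E₁ 1 :=
  (Tens.ofOneP (E₀ := E₀) (E₁ := E₁)).codRestrict _ (fun f => by
    have h : ∀ F : Tens E₀ E₁ 1, symm E₀ E₁ 1 F = F := fun F => by
      apply lp.ext; funext a
      rw [symm_apply]
      have ha : ∀ σ : Equiv.Perm (Fin 1), a ∘ σ = a := fun σ => by
        rw [Subsingleton.elim σ 1]; rfl
      have hs : ∀ σ : Equiv.Perm (Fin 1), sgn σ a = 1 := fun σ => by
        have : (Finset.univ.filter fun p : Fin 1 × Fin 1 => p.1 < p.2 ∧ σ p.2 < σ p.1 ∧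
            (a (σ p.1)).isOdd ∧ (a (σ p.2)).isOdd) = ∅ := by
          apply Finset.filter_false_of_mem
          rintro ⟨i, j⟩ _ ⟨hij, _⟩
          exact absurd hij (by simp [Subsingleton.elim i j])
        rw [sgn, this]; simp
      simp [ha, hs]
    rw [← h (Tens.ofOneP f)]
    exact symm_mem _)

/-- The graded product `F ⊙ G = √((p+q)! / (p! q!)) P (F ⊗ G)` of homogeneous tensors. -/
def symMul (p q : ℕ) :
    symTens E₀ E₁ p →L[ℂ] symTens E₀ E₁ q →L[ℂ] symTens E₀ E₁ (p + q) :=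
  LinearMap.mkContinuous₂
    (LinearMap.mk₂ ℂ
      (fun F G => (⟨((√(((p + q)! : ℝ) / ((p ! : ℝ) * (q ! : ℝ))) : ℝ) : ℂ) •
          symm E₀ E₁ (p + q) (tensMul E₀ E₁ p q F G),
        Submodule.smul_mem _ _ (symm_mem _)⟩ : symTens E₀ E₁ (p + q)))
      (fun F F' G => by
        apply Subtype.ext
        simp)
      (fun c F G => by
        apply Subtype.ext
        simp [smul_comm c])
      (fun F G G' => by
        apply Subtype.ext
        simp)
      (fun c F G => by
        apply Subtype.ext
        simp [smul_comm c]))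
    (√(((p + q)! : ℝ) / ((p ! : ℝ) * (q ! : ℝ)))) (fun F G => by
      have hS : ‖symm E₀ E₁ (p + q)‖ ≤ 1 := norm_symm_le
      have hT : ‖tensMul E₀ E₁ p q (F : Tens E₀ E₁ p) (G : Tens E₀ E₁ q)‖ ≤ ‖F‖ * ‖G‖ :=
        norm_tensMul_le p q _ _
      change ‖((√(((p + q)! : ℝ) / ((p ! : ℝ) * (q ! : ℝ))) : ℝ) : ℂ) •
          symm E₀ E₁ (p + q) (tensMul E₀ E₁ p q F G)‖ ≤ _
      rw [norm_smul, Complex.norm_real, Real.norm_of_nonneg (Real.sqrt_nonneg _), mul_assoc]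
      refine mul_le_mul_of_nonneg_left ?_ (Real.sqrt_nonneg _)
      refine ((symm E₀ E₁ (p + q)).le_of_opNorm_le hS _).trans ?_
      rw [one_mul]
      exact hT)

theorem norm_symMul_le (p q : ℕ) :
    ‖symMul E₀ E₁ p q‖ ≤ √(((p + q)! : ℝ) / ((p ! : ℝ) * (q ! : ℝ))) :=
  LinearMap.mkContinuous₂_norm_le _ (Real.sqrt_nonneg _) _

/-- The involution of `S_n(H)`. -/
def symStar (n : ℕ) : symTens E₀ E₁ n →L⋆[ℂ] symTens E₀ E₁ n :=
  ((Tens.star (E₀ := E₀) (E₁ := E₁) (n := n)).comp (symTens E₀ E₁ n).subtypeL).codRestrict _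
    (fun F => by
      refine map_mem_closure (f := Tens.star) (Tens.star (E₀ := E₀) (E₁ := E₁)).continuous F.2 ?_
      rintro _ ⟨G, rfl⟩
      exact ⟨Tens.star G, symm_star G⟩)

/-- The Fock space `S(H)`, the Hilbert sum of the spaces `S_n(H)`. -/
abbrev Fock : Type _ := lp (fun n : ℕ => symTens E₀ E₁ n) 2

/-- The involution of the Fock space. -/
def Fock.star : Fock E₀ E₁ →L⋆[ℂ] Fock E₀ E₁ :=
  lpMap (symStar E₀ E₁) 1 zero_le_one (fun n F => by
    rw [one_mul]
    exact Tens.norm_star_le (F : Tens E₀ E₁ n))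

/-- The bilinear form `⟨F | G⟩ = (F* | G)`. -/
def Fock.pairing : Fock E₀ E₁ →L[ℂ] Fock E₀ E₁ →L[ℂ] ℂ :=
  (innerSL ℂ).comp (Fock.star E₀ E₁)

variable {E₀ E₁}

theorem Fock.pairing_apply (F G : Fock E₀ E₁) :
    Fock.pairing E₀ E₁ F G = inner ℂ (Fock.star E₀ E₁ F) G := rfl

theorem Fock.star_star (F : Fock E₀ E₁) : Fock.star E₀ E₁ (Fock.star E₀ E₁ F) = F := by
  apply lp.ext; funext n
  apply Subtype.ext
  apply lp.ext; funext a
  change Tens.star (Tens.star (F n : Tens E₀ E₁ n)) a = _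
  simp

/-- The transposed operator `T' F = (T† F*)*`. -/
def Fock.transpose (T : Fock E₀ E₁ →L[ℂ] Fock E₀ E₁) : Fock E₀ E₁ →L[ℂ] Fock E₀ E₁ :=
  (Fock.star E₀ E₁).comp ((ContinuousLinearMap.adjoint T).comp (Fock.star E₀ E₁))

/-- The transposed operator is characterized by `⟨T' F | G⟩ = ⟨F | T G⟩`. -/
theorem Fock.pairing_transpose (T : Fock E₀ E₁ →L[ℂ] Fock E₀ E₁) (F G : Fock E₀ E₁) :
    Fock.pairing E₀ E₁ (Fock.transpose T F) G = Fock.pairing E₀ E₁ F (T G) := by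
  rw [Fock.pairing_apply, Fock.pairing_apply]
  change inner ℂ (Fock.star E₀ E₁ (Fock.star E₀ E₁
    (ContinuousLinearMap.adjoint T (Fock.star E₀ E₁ F)))) G = _
  rw [Fock.star_star, ContinuousLinearMap.adjoint_inner_left]

variable (E₀ E₁) in
/-- The inclusion of the tensors of degree `n`. -/
def Fock.incl (n : ℕ) : symTens E₀ E₁ n →L[ℂ] Fock E₀ E₁ :=
  lp.singleContinuousLinearMap ℂ (fun n : ℕ => symTens E₀ E₁ n) 2 n

variable (E₀ E₁) in
theorem Fock.norm_incl_le (n : ℕ) : ‖Fock.incl E₀ E₁ n‖ ≤ 1 :=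
  norm_single_le (V := fun n : ℕ => symTens E₀ E₁ n) n

end Fock

/-! ## Superspace, coherent states and the function space -/

section Superspace

variable (E₀ E₁ : Type*) [NormedAddCommGroup E₀] [InnerProductSpace ℂ E₀] [CompleteSpace E₀]
  [NormedAddCommGroup E₁] [InnerProductSpace ℂ E₁] [CompleteSpace E₁]

/-- The `Λ`-extended Fock space `S^Λ(H)`. -/
abbrev FockExt : Type _ := LExt (Fock E₀ E₁)

/-- The superspace `H_Λ`, the even part of `Λ ⊗ H`: the sum of `Λ₀ ⊗ H₀` and `Λ₁ ⊗ H₁`, where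
`e_A` is even or odd according to the parity of `|A|`. -/
def superspace : Set (LExt (OneP E₀ E₁)) :=
  {ζ | ∀ A, (Even A.card → (ζ A).snd = 0) ∧ (¬ Even A.card → (ζ A).fst = 0)}

/-- The real subspace `H_Λ^D` of the superspace. -/
def superspaceD : Set (LExt (OneP E₀ E₁)) :=
  {ζ | ζ ∈ superspace E₀ E₁ ∧ LExt.star (OneP.star E₀ E₁) ζ = ζ}

variable {E₀ E₁}

/-- The power `ζ^p` in the algebra `Λ ⊗ S(H)`, an element of degree `p`. -/
def superPow (ζ : LExt (OneP E₀ E₁)) : (p : ℕ) → LExt (symTens E₀ E₁ p)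
  | 0 => LExt.tmul Gr.unit (symOne E₀ E₁)
  | p + 1 => ext₂ (symMul E₀ E₁ p 1) (superPow ζ p) (LExt.map (symOfOneP E₀ E₁) ζ)

/-- The terms `ζ^p / p!` of the exponential series. -/
def superExpTerm (ζ : LExt (OneP E₀ E₁)) (p : ℕ) : FockExt E₀ E₁ :=
  ((p ! : ℂ)⁻¹) • LExt.map (Fock.incl E₀ E₁ p) (superPow ζ p)

theorem norm_superPow_le (ζ : LExt (OneP E₀ E₁)) (p : ℕ) :
    ‖superPow ζ p‖ ≤ √(p ! : ℝ) * (√3 * (‖symOfOneP E₀ E₁‖ * ‖ζ‖)) ^ p *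
      ‖LExt.tmul Gr.unit (symOne E₀ E₁)‖ := by
  induction p with
  | zero => simp [superPow]
  | succ p ih =>
    have h1 : ‖LExt.map (symOfOneP E₀ E₁) ζ‖ ≤ ‖symOfOneP E₀ E₁‖ * ‖ζ‖ :=
      (LExt.map (symOfOneP E₀ E₁)).le_of_opNorm_le (LExt.norm_map_le _) ζ
    have h0 : ‖symMul E₀ E₁ p 1‖ ≤ √((p + 1 : ℕ) : ℝ) := by
      refine (norm_symMul_le E₀ E₁ p 1).trans (le_of_eq ?_)
      congr 1
      rw [Nat.factorial_succ]
      push_cast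
      have : (p ! : ℝ) ≠ 0 := by positivity
      field_simp
      simp
    have h2 : ‖ext₂ (symMul E₀ E₁ p 1)‖ ≤ √3 * √((p + 1 : ℕ) : ℝ) :=
      (norm_ext₂_le _).trans (mul_le_mul_of_nonneg_left h0 (Real.sqrt_nonneg _))
    have h3 := (ext₂ (symMul E₀ E₁ p 1)).le_of_opNorm₂_le_of_le h2 ih h1
    refine h3.trans (le_of_eq ?_)
    rw [Nat.factorial_succ, Nat.cast_mul, Real.sqrt_mul (by positivity)]
    ring

/-- The exponential series converges absolutely. -/
theorem summable_superExpTerm (ζ : LExt (OneP E₀ E₁)) :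
    Summable fun p => ‖superExpTerm ζ p‖ := by
  set R : ℝ := √3 * (‖symOfOneP E₀ E₁‖ * ‖ζ‖) with hR
  set C : ℝ := ‖LExt.tmul Gr.unit (symOne E₀ E₁)‖ with hC
  have hR0 : 0 ≤ R := by positivity
  have hs : Summable fun p : ℕ => ((2 * R ^ 2) ^ p / (p ! : ℝ) + (1 / 2) ^ p) * C :=
    ((Real.summable_pow_div_factorial (2 * R ^ 2)).add summable_geometric_two).mul_right C
  refine Summable.of_nonneg_of_le (fun p => norm_nonneg _) (fun p => ?_) hs
  have h2 : ‖LExt.map (Fock.incl E₀ E₁ p) (superPow ζ p)‖ ≤ √(p ! : ℝ) * R ^ p * C :=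
    (LExt.norm_map_apply_le (Fock.incl E₀ E₁ p) (Fock.norm_incl_le E₀ E₁ p)
      (superPow ζ p)).trans (norm_superPow_le ζ p)
  have hp : (0 : ℝ) < p ! := by positivity
  have h3 : ‖superExpTerm ζ p‖ ≤ (R ^ p / √(p ! : ℝ)) * C := by
    rw [superExpTerm, norm_smul, norm_inv, Complex.norm_natCast]
    refine (mul_le_mul_of_nonneg_left h2 (by positivity)).trans (le_of_eq ?_)
    have h4 : (√(p ! : ℝ)) ≠ 0 := by positivity
    have h5 : (p ! : ℝ) = √(p ! : ℝ) * √(p ! : ℝ) := (Real.mul_self_sqrt hp.le).symm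
    nth_rewrite 1 [h5]
    field_simp
  refine h3.trans (mul_le_mul_of_nonneg_right ?_ (norm_nonneg _))
  have ha : (R ^ p / √(p ! : ℝ)) ^ 2 = ((2 * R ^ 2) ^ p / (p ! : ℝ)) * (1 / 2) ^ p := by
    rw [div_pow, Real.sq_sqrt hp.le, mul_pow, one_div, inv_pow]
    have : (2 : ℝ) ^ p ≠ 0 := by positivity
    field_simp
    ring
  have hb : (0 : ℝ) ≤ (2 * R ^ 2) ^ p / (p ! : ℝ) := by positivity
  have hc : (0 : ℝ) ≤ (1 / 2) ^ p := by positivity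
  refine le_of_sq_le_sq ?_ (by positivity)
  rw [ha]
  nlinarith

/-- The coherent state `exp ζ = ∑_p ζ^p / p!`. -/
def superExp (ζ : LExt (OneP E₀ E₁)) : FockExt E₀ E₁ := ∑' p, superExpTerm ζ p

/-- The `Λ`-bilinear form `⟨Ξ | Θ⟩` with `⟨x ⊗ F | y ⊗ G⟩ = x y ⟨F | G⟩`. -/
def bracket (Ξ Θ : FockExt E₀ E₁) : Gr := ext₂ (Fock.pairing E₀ E₁) Ξ Θ

/-- The `Λ`-sesquilinear form `(Ξ | Θ) = ⟨Ξ* | Θ⟩`. -/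
def sesq (Ξ Θ : FockExt E₀ E₁) : Gr := bracket (LExt.star (Fock.star E₀ E₁) Ξ) Θ

variable (E₀ E₁) in
/-- The map `Υ`, which sends `Ξ` to the function `φ_Ξ(ζ) = ⟨exp ζ | Ξ⟩` on `H_Λ^D`. -/
def toFun : FockExt E₀ E₁ →ₗ[ℂ] (superspaceD E₀ E₁ → Gr) where
  toFun Ξ ζ := bracket (superExp ζ.1) Ξ
  map_add' Ξ Θ := by
    funext ζ
    exact map_add (ext₂ (Fock.pairing E₀ E₁) (superExp ζ.1)) Ξ Θ
  map_smul' c Ξ := by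
    funext ζ
    exact map_smul (ext₂ (Fock.pairing E₀ E₁) (superExp ζ.1)) c Ξ

variable (E₀ E₁) in
/-- The function space `F^Λ(H_Λ^D)`, the image of `Υ`. -/
def funSpace : Submodule ℂ (superspaceD E₀ E₁ → Gr) := LinearMap.range (toFun E₀ E₁)

/-- The function `φ_Ξ` as an element of the function space. -/
def phi (Ξ : FockExt E₀ E₁) : funSpace E₀ E₁ := ⟨toFun E₀ E₁ Ξ, Ξ, rfl⟩

/-- The tensor `Ξ` with `φ_Ξ = f`. -/
def tensorOf (f : funSpace E₀ E₁) : FockExt E₀ E₁ := Classical.choose f.2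

theorem phi_tensorOf (f : funSpace E₀ E₁) : phi (tensorOf f) = f :=
  Subtype.ext (Classical.choose_spec f.2)

/-- The `Λ`-bilinear form `⟨φ_Ξ ‖ φ_Θ⟩ = ⟨Ξ | Θ⟩` of the function space. -/
def funPairing (f g : funSpace E₀ E₁) : Gr := bracket (tensorOf f) (tensorOf g)

/-- The representation `T_F` of `T` on the function space, with `T_F φ_Ξ = φ_{T Ξ}` for the
`Λ`-linear extension of `T`. -/
def funOp (T : Fock E₀ E₁ →L[ℂ] Fock E₀ E₁) (f : funSpace E₀ E₁) : funSpace E₀ E₁ :=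
  phi (LExt.map T (tensorOf f))

/-- The kernel `K_T(ζ₁, ζ₂) = ⟨T exp ζ₁ | exp ζ₂⟩`. -/
def opKernel (T : Fock E₀ E₁ →L[ℂ] Fock E₀ E₁) (ζ₁ ζ₂ : superspaceD E₀ E₁) : Gr :=
  bracket (LExt.map T (superExp ζ₁.1)) (superExp ζ₂.1)

end Superspace

end SuperFock

end

/-! Everything rests on two facts: `Ξ ↦ φ_Ξ` is injective, and `exp ζ` is real for real `ζ`. By
injectivity the tensor chosen by `tensorOf` is the only one, so the form and the operator on the
function space are those of the tensors (`tensorOf_phi`). The pairing of the Fock space is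
symmetric, so under the `Λ`-bilinear bracket `T` moves to the other side as `T'`
(`bracket_map_left`, `bracket_map_right`). Hence `K_T(·, η) = φ_Θ` with `Θ = T' exp η`, and `⟨T' exp
η | Ξ⟩ = ⟨exp η | T Ξ⟩` is the kernel formula. Reality of `exp ζ₁` turns the bilinear form into the
sesquilinear one.

Both facts need the coordinates of `ζ^p`. Its coefficient at `e_C` is a sum over ordered
decompositions of `C` into `p` disjoint sets, weighted by the structure constants of `Λ`
(`tensPow`). For `ζ` in the superspace the sign from reordering the Grassmann factors equals the
sign `χ_σ` from reordering the one-particle factors, so this sum is already graded symmetric and the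
symmetrizations inside `⊙` only contribute the normalization `√p!` (`superPow_apply`). Reality
follows by reversing the factors: the involutions of `Λ` and of the tensors both reverse products,
and their signs match (`tensPow_star`, `star_superPow`).

For injectivity, suppose `⟨exp ζ | Ξ⟩ = 0` for all real `ζ`, and that `Ξ` has no components of
degree less than `p`. Fix `A` and test with `ζ = ∑ e_{B i} ⊗ f i`, a sum of `p` terms with `f i`
real and homogeneous and the `B i` disjoint from each other and from `A`; infinitely many generators
leave room for them. Then `ζ^q = 0` for `q > p`, while `ζ^p` lives only on `U = ⋃ B i`, where it is
a nonzero multiple of `P(f 0 ⊗ ⋯ ⊗ f (p-1))`. The coefficient of the bracket at `e_{U ∪ A}`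
therefore isolates the pairing of this product with the degree `p` part of `Ξ A`. Real homogeneous
vectors span the basis vectors over `ℂ`, so that part vanishes (`eq_zero_of_inner_star_symm_prod`),
and induction on `p` gives `Ξ = 0`. -/

noncomputable section

namespace SuperFock

/-! ## Ordered decompositions of finite sets -/

section Decompositions

variable {p : ℕ}

/-- The product of `f i j` over the pairs `i < j`. -/
def pairProd (f : Fin p → Fin p → ℂ) : ℂ := ∏ i, ∏ j, if i < j then f i j else 1

theorem pairProd_succ (f : Fin (p + 1) → Fin (p + 1) → ℂ) :
    pairProd f = pairProd (fun i j => f i.castSucc j.castSucc) *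
      ∏ i : Fin p, f i.castSucc (Fin.last p) := by
  simp [pairProd, Fin.prod_univ_castSucc, Fin.castSucc_lt_last, Finset.prod_mul_distrib,
    Fin.not_lt.2 (Fin.le_last _)]

/-- Both sides run over the same unordered pairs. A pair whose order `σ` keeps contributes the same
factor to both; a pair that `σ` inverts contributes `f` with its arguments exchanged, and `h` pays
for this with one factor `e`. -/
theorem pairProd_comp_perm (σ : Equiv.Perm (Fin p)) (f e : Fin p → Fin p → ℂ)
    (h : ∀ i j, i ≠ j → f i j = e i j * f j i) :
    pairProd (fun i j => f (σ i) (σ j)) =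
      (∏ i, ∏ j, if i < j ∧ σ j < σ i then e (σ i) (σ j) else 1) * pairProd f := by
  -- Reindexed by `σ`, the ordered pairs split according to whether `σ` keeps or inverts them.
  have h1 : pairProd f = (∏ i, ∏ j, if i < j ∧ σ i < σ j then f (σ i) (σ j) else 1) *
      ∏ i, ∏ j, if i < j ∧ σ j < σ i then f (σ j) (σ i) else 1 := by
    have h2 : (∏ i, ∏ j, if i < j ∧ σ j < σ i then f (σ j) (σ i) else 1) =
        ∏ i, ∏ j, if j < i ∧ σ i < σ j then f (σ i) (σ j) else 1 := Finset.prod_comm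
    rw [h2, pairProd, ← Equiv.prod_comp σ, ← Finset.prod_mul_distrib]
    refine Finset.prod_congr rfl fun i _ => ?_
    rw [← Equiv.prod_comp σ, ← Finset.prod_mul_distrib]
    refine Finset.prod_congr rfl fun j _ => ?_
    rcases lt_trichotomy i j with hij | rfl | hij
    · simp [hij, hij.not_gt]
    · simp
    · simp [hij, hij.not_gt]
  rw [h1, pairProd, ← Finset.prod_mul_distrib, ← Finset.prod_mul_distrib]
  refine Finset.prod_congr rfl fun i _ => ?_
  rw [← Finset.prod_mul_distrib, ← Finset.prod_mul_distrib]
  refine Finset.prod_congr rfl fun j _ => ?_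
  by_cases hij : i < j
  · rcases lt_trichotomy (σ i) (σ j) with hs | hs | hs
    · simp [hij, hs, hs.not_gt]
    · exact absurd (σ.injective hs) hij.ne
    · simp only [hij, hs, hs.not_gt, and_true, and_false, if_true, if_false, one_mul]
      exact h _ _ hs.ne'
  · simp [hij]

/-- The sign of the reordering `e_{D 0} ⋯ e_{D (p-1)}` into increasing order. -/
def reorderSign (D : Fin p → Finset ℕ) : ℂ :=
  pairProd fun i j => (-1) ^ inversions (D i) (D j)

theorem reorderSign_ne_zero (D : Fin p → Finset ℕ) : reorderSign D ≠ 0 := by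
  rw [reorderSign, pairProd, Finset.prod_ne_zero_iff]
  refine fun i _ => Finset.prod_ne_zero_iff.2 fun j _ => ?_
  split_ifs <;> simp

/-- Disjointness excludes ties, so each pair of `B ×ˢ C` is counted by exactly one of the two terms.
This is the source of the commutation rule `e_B e_C = (-1)^(|B| |C|) e_C e_B`. -/
theorem inversions_add {B C : Finset ℕ} (h : Disjoint B C) :
    inversions B C + inversions C B = B.card * C.card := by
  have h1 : inversions C B = ((B ×ˢ C).filter fun q => ¬ q.2 < q.1).card := by
    refine Finset.card_bij' (fun q _ => q.swap) (fun q _ => q.swap) ?_ ?_ ?_ ?_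
    · rintro ⟨c, b⟩ hq
      simp only [Finset.mem_filter, Finset.mem_product, Prod.swap] at hq ⊢
      exact ⟨⟨hq.1.2, hq.1.1⟩, hq.2.not_gt⟩
    · rintro ⟨b, c⟩ hq
      simp only [Finset.mem_filter, Finset.mem_product, Prod.swap] at hq ⊢
      refine ⟨⟨hq.1.2, hq.1.1⟩, lt_of_le_of_ne (not_lt.1 hq.2) ?_⟩
      exact fun hbc => Finset.disjoint_left.1 h hq.1.1 (hbc ▸ hq.1.2)
    · simp
    · simp
  rw [h1, inversions, Finset.card_filter_add_card_filter_not, Finset.card_product]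

theorem reorderSign_comp_perm (σ : Equiv.Perm (Fin p)) (D : Fin p → Finset ℕ)
    (hD : Pairwise (Function.onFun Disjoint D)) :
    reorderSign (D ∘ σ) =
      (∏ i, ∏ j, if i < j ∧ σ j < σ i then (-1) ^ ((D (σ i)).card * (D (σ j)).card) else 1) *
        reorderSign D := by
  refine pairProd_comp_perm σ (fun i j => (-1) ^ inversions (D i) (D j))
    (fun i j => (-1) ^ ((D i).card * (D j).card)) fun i j hij => ?_
  rw [← inversions_add (hD hij), pow_add, mul_assoc, ← mul_pow]
  simp

/-- Reversal inverts every pair, so every exchange sign occurs exactly once. -/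
theorem reorderSign_comp_rev (D : Fin p → Finset ℕ)
    (hD : Pairwise (Function.onFun Disjoint D)) :
    reorderSign (D ∘ Fin.revPerm) =
      pairProd (fun i j => (-1) ^ ((D i).card * (D j).card)) * reorderSign D := by
  rw [reorderSign_comp_perm _ _ hD]
  congr 1
  rw [pairProd, Finset.prod_comm, ← Equiv.prod_comp Fin.revPerm]
  refine Finset.prod_congr rfl fun i _ => ?_
  rw [← Equiv.prod_comp Fin.revPerm]
  refine Finset.prod_congr rfl fun j _ => ?_
  simp [mul_comm]

/-- A two-element subset of a union of two blocks lies in one block or meets both. -/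
theorem neg_one_pow_choose_add (m n : ℕ) :
    (-1 : ℂ) ^ (m + n).choose 2 = (-1) ^ m.choose 2 * (-1) ^ n.choose 2 * (-1) ^ (m * n) := by
  rw [← pow_add, ← pow_add]
  congr 1
  induction n with
  | zero => simp
  | succ n ih =>
    rw [← add_assoc, Nat.choose_succ_succ' (m + n) 1, Nat.choose_succ_succ' n 1, ih]
    simp only [Nat.choose_one_right]
    ring

theorem neg_one_pow_choose_sum (f : Fin p → ℕ) :
    (-1 : ℂ) ^ (∑ i, f i).choose 2 =
      (∏ i, (-1) ^ (f i).choose 2) * pairProd fun i j => (-1) ^ (f i * f j) := by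
  induction p with
  | zero => simp [pairProd]
  | succ p ih =>
    rw [Fin.sum_univ_castSucc, neg_one_pow_choose_add, ih, pairProd_succ,
      Fin.prod_univ_castSucc, Finset.sum_mul,
      Finset.prod_pow_eq_pow_sum _ (fun i : Fin p => f i.castSucc * f (Fin.last p)) (-1 : ℂ)]
    ring

/-- The ordered decompositions of `C` into `p` disjoint subsets. -/
def parts (p : ℕ) (C : Finset ℕ) : Finset (Fin p → Finset ℕ) :=
  open Classical in
  (Fintype.piFinset fun _ => C.powerset).filter fun D =>
    Pairwise (Function.onFun Disjoint D) ∧ Finset.univ.biUnion D = C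

theorem mem_parts {C : Finset ℕ} {D : Fin p → Finset ℕ} :
    D ∈ parts p C ↔ Pairwise (Function.onFun Disjoint D) ∧ Finset.univ.biUnion D = C := by
  classical
  simp only [parts, Finset.mem_filter, Fintype.mem_piFinset, Finset.mem_powerset,
    and_iff_right_iff_imp]
  rintro ⟨-, rfl⟩ i
  exact Finset.subset_biUnion_of_mem D (Finset.mem_univ i)

theorem comp_mem_parts_iff {C : Finset ℕ} {D : Fin p → Finset ℕ} (σ : Equiv.Perm (Fin p)) :
    D ∘ σ ∈ parts p C ↔ D ∈ parts p C := by
  have h : ∀ (D : Fin p → Finset ℕ) (σ : Equiv.Perm (Fin p)), D ∈ parts p C →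
      D ∘ σ ∈ parts p C := by
    intro D σ hD
    rw [mem_parts] at hD ⊢
    refine ⟨fun i j hij => hD.1 (σ.injective.ne hij), ?_⟩
    rw [← hD.2]
    ext x
    simp only [Finset.mem_biUnion, Finset.mem_univ, true_and, Function.comp_apply]
    exact σ.exists_congr_left.trans (by simp)
  refine ⟨fun hD => ?_, h D σ⟩
  have := h _ σ⁻¹ hD
  rwa [Function.comp_assoc, show (σ : Fin p → Fin p) ∘ (σ⁻¹ : Equiv.Perm (Fin p)) = id from
    funext fun i => by simp] at this

theorem card_of_mem_parts {C : Finset ℕ} {D : Fin p → Finset ℕ} (hD : D ∈ parts p C) :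
    C.card = ∑ i, (D i).card := by
  rw [mem_parts] at hD
  rw [← hD.2, Finset.card_biUnion fun i _ j _ hij => hD.1 hij]

/-- The coefficient of `e_C` in `e_{D 0} ⋯ e_{D (p-1)}`, for a decomposition `D` of `C`. -/
def partCoeff (D : Fin p → Finset ℕ) : ℂ :=
  reorderSign D * ((∏ i, ((D i).card ! : ℂ)) / ((∑ i, (D i).card) ! : ℂ))

theorem partCoeff_ne_zero (D : Fin p → Finset ℕ) : partCoeff D ≠ 0 := by
  refine mul_ne_zero (reorderSign_ne_zero D) (div_ne_zero ?_ ?_)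
  · exact Finset.prod_ne_zero_iff.2 fun i _ => Nat.cast_ne_zero.2 (Nat.factorial_ne_zero _)
  · exact Nat.cast_ne_zero.2 (Nat.factorial_ne_zero _)

/-- The factorial weight is symmetric in the sets, so only the reordering sign changes. -/
theorem partCoeff_comp_perm (σ : Equiv.Perm (Fin p)) (D : Fin p → Finset ℕ)
    (hD : Pairwise (Function.onFun Disjoint D)) :
    partCoeff (D ∘ σ) =
      (∏ i, ∏ j, if i < j ∧ σ j < σ i then (-1) ^ ((D (σ i)).card * (D (σ j)).card) else 1) *
        partCoeff D := by
  rw [partCoeff, partCoeff, reorderSign_comp_perm σ D hD, mul_assoc]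
  simp only [Function.comp_apply]
  rw [Equiv.prod_comp σ (fun i => ((D i).card ! : ℂ)), Equiv.sum_comp σ (fun i => (D i).card)]

/-- Reversing a word of `|C|` generators amounts to reversing the order of the blocks and then each
block. The two binomial signs are therefore the difference between reversing blocks and applying the
involution of `Λ`. -/
theorem partCoeff_comp_rev {C : Finset ℕ} {D : Fin p → Finset ℕ} (hD : D ∈ parts p C) :
    partCoeff (D ∘ Fin.revPerm) =
      (-1) ^ C.card.choose 2 * (∏ i, (-1) ^ (D i).card.choose 2) * partCoeff D := by
  rw [partCoeff, partCoeff, reorderSign_comp_rev D (mem_parts.1 hD).1, card_of_mem_parts hD,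
    neg_one_pow_choose_sum]
  simp only [Function.comp_apply]
  rw [Equiv.prod_comp Fin.revPerm (fun i => ((D i).card ! : ℂ)),
    Equiv.sum_comp Fin.revPerm (fun i => (D i).card)]
  have h : (∏ i, (-1 : ℂ) ^ (D i).card.choose 2) * ∏ i, (-1 : ℂ) ^ (D i).card.choose 2 = 1 := by
    rw [← Finset.prod_mul_distrib]
    exact Finset.prod_eq_one fun i _ => by rw [← mul_pow]; simp
  linear_combination (-(pairProd fun i j => (-1) ^ ((D i).card * (D j).card)) * reorderSign D *
    ((∏ i, ((D i).card ! : ℂ)) / ((∑ i, (D i).card) ! : ℂ))) * h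

theorem inversions_biUnion {D : Fin p → Finset ℕ} (hD : Pairwise (Function.onFun Disjoint D))
    (C : Finset ℕ) : inversions (Finset.univ.biUnion D) C = ∑ i, inversions (D i) C := by
  classical
  simp only [inversions]
  rw [← Finset.card_biUnion]
  · congr 1
    ext q
    simp
  · intro i _ j _ hij
    refine Finset.disjoint_left.2 ?_
    intro q hq hq'
    simp only [Finset.mem_filter, Finset.mem_product] at hq hq'
    exact Finset.disjoint_left.1 (hD hij) hq.1.1 hq'.1.1

/-- Inversions against a disjoint union add up, and the `|B|!` of `mulCoeff` cancels the denominator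
of the shorter coefficient. The closed formula thus obeys the recursion of multiplication by one
more factor. -/
theorem partCoeff_succ {B C : Finset ℕ} {D : Fin (p + 1) → Finset ℕ}
    (hD : Fin.init D ∈ parts p B) (hC : D (Fin.last p) = C) :
    partCoeff D = mulCoeff B C * partCoeff (Fin.init D) := by
  have h1 := card_of_mem_parts hD
  have h2 := (mem_parts.1 hD).2
  rw [partCoeff, partCoeff, reorderSign, reorderSign, pairProd_succ, mulCoeff,
    Finset.prod_pow_eq_pow_sum, Fin.prod_univ_castSucc, Fin.sum_univ_castSucc, hC]
  have h3 := inversions_biUnion (mem_parts.1 hD).1 C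
  rw [h2] at h3
  simp only [Fin.init] at h1 h3 ⊢
  rw [← h3, ← h1]
  have h4 : (B.card ! : ℂ) ≠ 0 := Nat.cast_ne_zero.2 (Nat.factorial_ne_zero _)
  push_cast
  field_simp

theorem sdiff_init_of_mem_parts {C : Finset ℕ} {D : Fin (p + 1) → Finset ℕ}
    (hD : D ∈ parts (p + 1) C) : C \ Finset.univ.biUnion (Fin.init D) = D (Fin.last p) := by
  obtain ⟨h1, h2⟩ := mem_parts.1 hD
  have h3 : Disjoint (D (Fin.last p)) (Finset.univ.biUnion (Fin.init D)) :=
    (Finset.disjoint_biUnion_right _ _ _).2 fun i _ => h1 (Fin.castSucc_lt_last i).ne'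
  rw [← h2]
  ext x
  have hx : x ∈ D (Fin.last p) → ¬ ∃ i : Fin p, x ∈ D i.castSucc := fun hx hx' =>
    Finset.disjoint_left.1 h3 hx (by simpa [Fin.init] using hx')
  simp only [Fin.init, Finset.mem_sdiff, Finset.mem_biUnion, Finset.mem_univ, true_and,
    Fin.exists_fin_succ']
  tauto

/-- The decompositions of `C` into `p + 1` sets, according to the union `B` of the first `p`. -/
theorem sum_parts_succ (C : Finset ℕ) (f : (Fin (p + 1) → Finset ℕ) → ℂ) :
    ∑ D ∈ parts (p + 1) C, f D =
      ∑ B ∈ C.powerset, ∑ D ∈ parts p B, f (Fin.snoc (α := fun _ => Finset ℕ) D (C \ B)) := by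
  classical
  rw [Finset.sum_sigma' C.powerset (fun B => parts p B)]
  refine Finset.sum_bij' (fun D _ => ⟨Finset.univ.biUnion (Fin.init D), Fin.init D⟩)
    (fun q _ => Fin.snoc (α := fun _ => Finset ℕ) q.2 (C \ q.1)) ?_ ?_ ?_ ?_ ?_
  · intro D hD
    obtain ⟨h1, h2⟩ := mem_parts.1 hD
    rw [Finset.mem_sigma, Finset.mem_powerset, mem_parts]
    refine ⟨?_, fun i j hij => h1 (by simpa using hij), rfl⟩
    rw [← h2]
    exact Finset.biUnion_subset.2 fun i _ =>
      Finset.subset_biUnion_of_mem D (Finset.mem_univ i.castSucc)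
  · rintro ⟨B, D⟩ hq
    rw [Finset.mem_sigma, Finset.mem_powerset, mem_parts] at hq
    obtain ⟨hB, h1, h2⟩ := hq
    dsimp only at hB h1 h2
    have hd : ∀ i, D i ⊆ B := fun i => by
      rw [← h2]; exact Finset.subset_biUnion_of_mem D (Finset.mem_univ i)
    rw [mem_parts]
    constructor
    · intro i j hij
      induction i using Fin.lastCases with
      | last =>
        induction j using Fin.lastCases with
        | last => exact absurd rfl hij
        | cast j =>
          simpa [Function.onFun] using
            Finset.sdiff_disjoint.mono_right (hd j)
      | cast i =>
        induction j using Fin.lastCases with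
        | last =>
          simpa [Function.onFun] using
            Finset.disjoint_sdiff.mono_left (hd i)
        | cast j =>
          simpa [Function.onFun] using h1 (by simpa using hij)
    · ext x
      have hx : x ∈ B ↔ ∃ i, x ∈ D i := by rw [← h2]; simp
      have hx' := @hB x
      simp [Fin.exists_fin_succ']
      tauto
  · intro D hD
    rw [sdiff_init_of_mem_parts hD, Fin.snoc_init_self]
  · rintro ⟨B, D⟩ hq
    rw [Finset.mem_sigma, Finset.mem_powerset, mem_parts] at hq
    simp [hq.2.2]
  · intro D hD
    rw [sdiff_init_of_mem_parts hD, Fin.snoc_init_self]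

end Decompositions

/-! ## Coordinates of the powers of a superspace element -/

section Powers

variable {E₀ E₁ : Type*} [NormedAddCommGroup E₀] [InnerProductSpace ℂ E₀] [CompleteSpace E₀]
  [NormedAddCommGroup E₁] [InnerProductSpace ℂ E₁] [CompleteSpace E₁] {p : ℕ}

theorem sgn_eq_prod (σ : Equiv.Perm (Fin p)) (a : Fin p → Mode E₀ E₁) :
    sgn σ a = ∏ i, ∏ j, if i < j ∧ σ j < σ i then
      (if (a (σ i)).isOdd ∧ (a (σ j)).isOdd then -1 else 1) else 1 := by
  rw [sgn, ← Finset.prod_const, Finset.prod_filter, ← Finset.univ_product_univ,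
    Finset.prod_product]
  refine Finset.prod_congr rfl fun i _ => Finset.prod_congr rfl fun j _ => ?_
  simp only [← ite_and, and_assoc]

theorem sgn_mul_self (σ : Equiv.Perm (Fin p)) (a : Fin p → Mode E₀ E₁) :
    sgn σ a * sgn σ a = 1 := by
  rw [sgn, ← mul_pow]
  simp

/-- The exchange sign `(-1)^(|D i| |D j|)` is `-1` exactly when both sets are odd. Under the
superspace parity rule this means that both modes are fermionic, so Grassmann and tensor signs
coincide. -/
theorem partCoeff_comp_perm_eq_sgn (σ : Equiv.Perm (Fin p)) {D : Fin p → Finset ℕ}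
    (hD : Pairwise (Function.onFun Disjoint D)) {a : Fin p → Mode E₀ E₁}
    (ha : ∀ i, Odd (D i).card ↔ (a i).isOdd) :
    partCoeff (D ∘ σ) = sgn σ a * partCoeff D := by
  rw [partCoeff_comp_perm σ D hD, sgn_eq_prod]
  congr 1
  refine Finset.prod_congr rfl fun i _ => Finset.prod_congr rfl fun j _ => ?_
  congr 1
  simp only [← ha, ← Nat.odd_mul]
  split_ifs with h
  · exact h.neg_one_pow
  · exact (Nat.not_odd_iff_even.1 h).neg_one_pow

theorem Doubled.coord_zero {E : Type*} [NormedAddCommGroup E] [InnerProductSpace ℂ E]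
    [CompleteSpace E] (k : BasisIndex E × Bool) : Doubled.coord (0 : Doubled E) k = 0 := by
  rcases k with ⟨i, _ | _⟩ <;> simp [Doubled.coord]

theorem odd_card_iff_of_coord_ne_zero {ζ : LExt (OneP E₀ E₁)} (hζ : ζ ∈ superspace E₀ E₁)
    {B : Finset ℕ} {m : Mode E₀ E₁} (h : (ζ B).coord m ≠ 0) : Odd B.card ↔ m.isOdd := by
  by_cases hB : Even B.card
  · rcases m with k | k
    · simpa [Mode.isOdd] using hB
    · refine absurd ?_ h
      rw [OneP.coord, (hζ B).1 hB, Doubled.coord_zero]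
  · rcases m with k | k
    · refine absurd ?_ h
      rw [OneP.coord, (hζ B).2 hB, Doubled.coord_zero]
    · simpa [Mode.isOdd] using hB

/-- The coordinate at `e_C ⊗ e_{a 0} ⊗ ⋯ ⊗ e_{a (p-1)}` of the `p`-th power of `ζ` in the
`Λ`-extension of the tensor algebra. -/
def tensPow (ζ : LExt (OneP E₀ E₁)) (p : ℕ) (C : Finset ℕ) (a : Fin p → Mode E₀ E₁) : ℂ :=
  ∑ D ∈ parts p C, partCoeff D * ∏ i, (ζ (D i)).coord (a i)

theorem sum_parts_comp_perm (σ : Equiv.Perm (Fin p)) (C : Finset ℕ)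
    (f : (Fin p → Finset ℕ) → ℂ) : ∑ D ∈ parts p C, f (D ∘ σ) = ∑ D ∈ parts p C, f D :=
  Finset.sum_equiv (Equiv.arrowCongr σ.symm (Equiv.refl (Finset ℕ)))
    (fun _ => (comp_mem_parts_iff σ).symm) (fun _ _ => rfl)

theorem tensPow_comp_perm {ζ : LExt (OneP E₀ E₁)} (hζ : ζ ∈ superspace E₀ E₁)
    (σ : Equiv.Perm (Fin p)) (C : Finset ℕ) (a : Fin p → Mode E₀ E₁) :
    tensPow ζ p C (a ∘ σ) = sgn σ a * tensPow ζ p C a := by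
  rw [tensPow, ← sum_parts_comp_perm σ, tensPow, Finset.mul_sum]
  refine Finset.sum_congr rfl fun D hD => ?_
  simp only [Function.comp_apply]
  rw [Equiv.prod_comp σ (fun i => (ζ (D i)).coord (a i))]
  -- The parity match is available only where all coordinates are nonzero; the remaining terms
  -- vanish on both sides.
  by_cases h : ∏ i, (ζ (D i)).coord (a i) = 0
  · simp [h]
  · rw [partCoeff_comp_perm_eq_sgn σ (mem_parts.1 hD).1 fun i =>
      odd_card_iff_of_coord_ne_zero hζ (Finset.prod_ne_zero_iff.1 h i (Finset.mem_univ i))]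
    ring

theorem tensPow_succ (ζ : LExt (OneP E₀ E₁)) (C : Finset ℕ) (a : Fin (p + 1) → Mode E₀ E₁) :
    tensPow ζ (p + 1) C a = ∑ B ∈ C.powerset, (mulCoeff B (C \ B) : ℂ) *
      (tensPow ζ p B (fun i => a i.castSucc) * (ζ (C \ B)).coord (a (Fin.last p))) := by
  rw [tensPow, sum_parts_succ]
  refine Finset.sum_congr rfl fun B _ => ?_
  rw [tensPow, Finset.sum_mul, Finset.mul_sum]
  refine Finset.sum_congr rfl fun D hD => ?_
  rw [partCoeff_succ (B := B) (C := C \ B) (by simpa using hD) (by simp), Fin.prod_univ_castSucc]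
  simp only [Fin.init_snoc, Fin.snoc_castSucc, Fin.snoc_last]
  ring

theorem symMul_coe (p q : ℕ) (F : symTens E₀ E₁ p) (G : symTens E₀ E₁ q) :
    (symMul E₀ E₁ p q F G : Tens E₀ E₁ (p + q)) =
      ((√(((p + q)! : ℝ) / ((p ! : ℝ) * (q ! : ℝ))) : ℝ) : ℂ) •
        symm E₀ E₁ (p + q) (tensMul E₀ E₁ p q F G) := rfl

theorem coe_superPow_succ (ζ : LExt (OneP E₀ E₁)) (p : ℕ) (C : Finset ℕ) :
    (superPow ζ (p + 1) C : Tens E₀ E₁ (p + 1)) = ((√((p + 1 : ℕ) : ℝ) : ℝ) : ℂ) •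
      symm E₀ E₁ (p + 1) (∑ B ∈ C.powerset, (mulCoeff B (C \ B) : ℂ) •
        tensMul E₀ E₁ p 1 (superPow ζ p B) (Tens.ofOneP (ζ (C \ B)))) := by
  have h : ((p + 1)! : ℝ) / ((p ! : ℝ) * (1 ! : ℝ)) = ((p + 1 : ℕ) : ℝ) := by
    rw [Nat.factorial_succ]
    have : (p ! : ℝ) ≠ 0 := by positivity
    push_cast
    field_simp
    simp
  rw [superPow, ext₂_apply, Submodule.coe_sum, map_sum, Finset.smul_sum]
  refine Finset.sum_congr rfl fun B _ => ?_
  rw [Submodule.coe_smul, symMul_coe, h, map_smul, smul_comm]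
  rfl

/-- By `tensPow_comp_perm` the tensor power is already graded symmetric, so symmetrizing at each
step leaves it fixed. The factors `√(p+1)` of the successive products accumulate to `√p!`. -/
theorem superPow_apply {ζ : LExt (OneP E₀ E₁)} (hζ : ζ ∈ superspace E₀ E₁) (p : ℕ)
    (C : Finset ℕ) (a : Fin p → Mode E₀ E₁) :
    (superPow ζ p C : Tens E₀ E₁ p) a = ((√(p ! : ℝ) : ℝ) : ℂ) * tensPow ζ p C a := by
  induction p generalizing C with
  | zero =>
    have ha : a = fun i => i.elim0 := Subsingleton.elim _ _
    subst ha
    by_cases hC : C = ∅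
    · subst hC
      have h : parts 0 ∅ = {fun i => i.elim0} := by
        ext D
        simp [mem_parts, Subsingleton.elim D (fun i => i.elim0), Pairwise]
      simp [superPow, LExt.tmul, Gr.unit, symOne, Tens.one, tensPow, h, partCoeff, reorderSign,
        pairProd]
    · have h : parts 0 C = ∅ := by
        ext D
        simp [mem_parts, Ne.symm hC]
      simp [superPow, LExt.tmul, Gr.unit, tensPow, h, hC]
  | succ p ih =>
    rw [coe_superPow_succ, lp.coeFn_smul, Pi.smul_apply, symm_apply, smul_eq_mul]
    -- All `(p+1)!` terms of the symmetrization are equal, since the sign of `σ` appears twice.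
    have h1 : ∀ σ : Equiv.Perm (Fin (p + 1)),
        sgn σ a * (∑ B ∈ C.powerset, (mulCoeff B (C \ B) : ℂ) •
          tensMul E₀ E₁ p 1 (superPow ζ p B) (Tens.ofOneP (ζ (C \ B))) :
            Tens E₀ E₁ (p + 1)) (a ∘ σ) = ((√(p ! : ℝ) : ℝ) : ℂ) * tensPow ζ (p + 1) C a := by
      intro σ
      have h2 : (∑ B ∈ C.powerset, (mulCoeff B (C \ B) : ℂ) •
          tensMul E₀ E₁ p 1 (superPow ζ p B) (Tens.ofOneP (ζ (C \ B))) :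
            Tens E₀ E₁ (p + 1)) (a ∘ σ) =
          ((√(p ! : ℝ) : ℝ) : ℂ) * tensPow ζ (p + 1) C (a ∘ σ) := by
        rw [lp.coeFn_sum, Finset.sum_apply, tensPow_succ, Finset.mul_sum]
        refine Finset.sum_congr rfl fun B _ => ?_
        rw [lp.coeFn_smul, Pi.smul_apply, tensMul_apply, ih, smul_eq_mul]
        change _ * (((√(p ! : ℝ) : ℝ) : ℂ) * tensPow ζ p B (fun i => (a ∘ σ) i.castSucc) *
          (ζ (C \ B)).coord ((a ∘ σ) (Fin.last p))) = _
        ring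
      rw [h2, tensPow_comp_perm hζ]
      linear_combination (((√(p ! : ℝ) : ℝ) : ℂ) * tensPow ζ (p + 1) C a) * sgn_mul_self σ a
    rw [Finset.sum_congr rfl fun σ _ => h1 σ, Finset.sum_const, Finset.card_univ,
      Fintype.card_perm, Fintype.card_fin, nsmul_eq_mul, Nat.factorial_succ, Nat.cast_mul,
      Nat.cast_mul, Real.sqrt_mul (by positivity)]
    have h3 : (p ! : ℂ) ≠ 0 := Nat.cast_ne_zero.2 (Nat.factorial_ne_zero _)
    have h4 : ((p + 1 : ℕ) : ℂ) ≠ 0 := Nat.cast_ne_zero.2 (Nat.succ_ne_zero _)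
    push_cast at h4 ⊢
    field_simp

/-! ## Coherent states of real superspace elements are real -/

theorem OneP.coord_star (f : OneP E₀ E₁) (m : Mode E₀ E₁) :
    (OneP.star E₀ E₁ f).coord m = conj (f.coord m.bar) := by
  have h := congrArg (fun F : Tens E₀ E₁ 1 => F fun _ => m) (Tens.star_ofOneP f)
  exact h.symm

theorem OneP.coord_add (f g : OneP E₀ E₁) (m : Mode E₀ E₁) :
    (f + g).coord m = f.coord m + g.coord m :=
  congrArg (fun F : Tens E₀ E₁ 1 => F fun _ => m) (map_add Tens.ofOneP f g)

theorem OneP.coord_smul (c : ℂ) (f : OneP E₀ E₁) (m : Mode E₀ E₁) :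
    (c • f).coord m = c * f.coord m :=
  congrArg (fun F : Tens E₀ E₁ 1 => F fun _ => m) (map_smul Tens.ofOneP c f)

theorem conj_partCoeff (D : Fin p → Finset ℕ) : conj (partCoeff D) = partCoeff D := by
  simp [partCoeff, reorderSign, pairProd, apply_ite]

/-- Reality of `ζ` gives one sign `(-1)^(|D i| choose 2)` per factor, and reversing the
decomposition gives the same signs again together with the sign of `C`. Each sign occurs twice and
cancels. -/
theorem tensPow_star {ζ : LExt (OneP E₀ E₁)} (hζ : LExt.star (OneP.star E₀ E₁) ζ = ζ)
    (C : Finset ℕ) (a : Fin p → Mode E₀ E₁) :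
    (-1) ^ C.card.choose 2 * conj (tensPow ζ p C fun i => (a i.rev).bar) = tensPow ζ p C a := by
  have h1 : ∀ B m, conj ((ζ B).coord (Mode.bar m)) = (-1) ^ B.card.choose 2 * (ζ B).coord m := by
    intro B m
    have h2 : (ζ B).coord m = (-1) ^ B.card.choose 2 * conj ((ζ B).coord m.bar) := by
      rw [← OneP.coord_star, ← OneP.coord_smul]
      exact congrArg (fun ξ : LExt (OneP E₀ E₁) => (ξ B).coord m) hζ.symm
    rw [h2, ← mul_assoc, ← mul_pow]
    simp
  rw [tensPow, ← sum_parts_comp_perm Fin.revPerm, tensPow, map_sum, Finset.mul_sum]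
  refine Finset.sum_congr rfl fun D hD => ?_
  have h5 : ∏ i, (ζ ((D ∘ Fin.revPerm) i)).coord (a i.rev).bar =
      ∏ i, (ζ (D i)).coord (a i).bar :=
    Equiv.prod_comp Fin.revPerm (fun i => (ζ (D i)).coord (a i).bar)
  rw [h5, map_mul, conj_partCoeff,
    partCoeff_comp_rev hD, map_prod, Finset.prod_congr rfl fun i _ => h1 (D i) (a i),
    Finset.prod_mul_distrib]
  have h3 : (∏ i, (-1 : ℂ) ^ (D i).card.choose 2) * ∏ i, (-1 : ℂ) ^ (D i).card.choose 2 = 1 := by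
    rw [← Finset.prod_mul_distrib]
    exact Finset.prod_eq_one fun i _ => by rw [← mul_pow]; simp
  have h4 : (-1 : ℂ) ^ C.card.choose 2 * (-1 : ℂ) ^ C.card.choose 2 = 1 := by
    rw [← mul_pow]; simp
  linear_combination (partCoeff D * ∏ i, (ζ (D i)).coord (a i)) *
    ((∏ i, (-1 : ℂ) ^ (D i).card.choose 2) * ∏ i, (-1 : ℂ) ^ (D i).card.choose 2) * h4 +
    (partCoeff D * ∏ i, (ζ (D i)).coord (a i)) * h3

theorem star_superPow {ζ : LExt (OneP E₀ E₁)} (hζ : ζ ∈ superspaceD E₀ E₁) (p : ℕ) :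
    LExt.star (symStar E₀ E₁ p) (superPow ζ p) = superPow ζ p := by
  apply lp.ext; funext C
  apply Subtype.ext
  apply lp.ext; funext a
  have h : ((LExt.star (symStar E₀ E₁ p) (superPow ζ p) C : symTens E₀ E₁ p) :
      Tens E₀ E₁ p) a = (-1) ^ C.card.choose 2 *
        conj ((superPow ζ p C : Tens E₀ E₁ p) fun i => (a i.rev).bar) := rfl
  rw [h, superPow_apply hζ.1, superPow_apply hζ.1, ← tensPow_star hζ.2 C a, map_mul,
    Complex.conj_ofReal]
  ring

theorem star_map_incl (Θ : LExt (symTens E₀ E₁ p)) :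
    LExt.star (Fock.star E₀ E₁) (LExt.map (Fock.incl E₀ E₁ p) Θ) =
      LExt.map (Fock.incl E₀ E₁ p) (LExt.star (symStar E₀ E₁ p) Θ) := by
  apply lp.ext; funext C
  apply lp.ext; funext n
  change (-1 : ℂ) ^ C.card.choose 2 • symStar E₀ E₁ n ((lp.single 2 p (Θ C) : Fock E₀ E₁) n) =
    (lp.single 2 p ((-1 : ℂ) ^ C.card.choose 2 • symStar E₀ E₁ p (Θ C)) : Fock E₀ E₁) n
  by_cases h : n = p
  · subst h
    rw [lp.single_apply_self, lp.single_apply_self]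
  · rw [lp.single_apply_ne _ _ _ h, lp.single_apply_ne _ _ _ h, map_zero, smul_zero]

/-- The involution is continuous, so it passes through the series; each power is real and the
coefficients `1/p!` are real. -/
theorem star_superExp {ζ : LExt (OneP E₀ E₁)} (hζ : ζ ∈ superspaceD E₀ E₁) :
    LExt.star (Fock.star E₀ E₁) (superExp ζ) = superExp ζ := by
  rw [superExp, ContinuousLinearMap.map_tsum _ (summable_superExpTerm ζ).of_norm]
  refine tsum_congr fun p => ?_
  rw [superExpTerm, map_smulₛₗ, star_map_incl, star_superPow hζ]
  simp

/-! ## Transposed operators -/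

/-- In coordinates the pairing sums `F` at the reversed, conjugated index times `G` at the index.
Reversal with conjugation of modes is an involution of the indices, and reindexing by it exchanges
`F` and `G`. -/
theorem Fock.pairing_comm (F G : Fock E₀ E₁) :
    Fock.pairing E₀ E₁ F G = Fock.pairing E₀ E₁ G F := by
  rw [Fock.pairing_apply, Fock.pairing_apply, lp.inner_eq_tsum, lp.inner_eq_tsum]
  refine tsum_congr fun n => ?_
  rw [Submodule.coe_inner, Submodule.coe_inner, lp.inner_eq_tsum, lp.inner_eq_tsum,
    ← Equiv.tsum_eq (Equiv.arrowCongr (Fin.revPerm (n := n))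
      (Function.Involutive.toPerm Mode.bar (Mode.bar_bar (E₀ := E₀) (E₁ := E₁))))]
  refine tsum_congr fun a => ?_
  change inner ℂ (conj ((F n : Tens E₀ E₁ n) fun i => (a i.rev.rev).bar.bar))
    ((G n : Tens E₀ E₁ n) fun i => (a i.rev).bar) =
    inner ℂ (conj ((G n : Tens E₀ E₁ n) fun i => (a i.rev).bar)) ((F n : Tens E₀ E₁ n) a)
  simp [mul_comm]

/-- `T` acts only on the Fock factor, so the claim is checked on each coefficient. Symmetry of the
pairing is needed because `Fock.pairing_transpose` treats an operator in the second slot. -/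
theorem bracket_map_left (T : Fock E₀ E₁ →L[ℂ] Fock E₀ E₁) (Ξ Θ : FockExt E₀ E₁) :
    bracket (LExt.map T Ξ) Θ = bracket Ξ (LExt.map (Fock.transpose T) Θ) := by
  apply lp.ext; funext A
  refine Finset.sum_congr rfl fun B _ => ?_
  congr 1
  change Fock.pairing E₀ E₁ (T (Ξ B)) (Θ (A \ B)) =
    Fock.pairing E₀ E₁ (Ξ B) (Fock.transpose T (Θ (A \ B)))
  rw [Fock.pairing_comm, ← Fock.pairing_transpose, Fock.pairing_comm]

theorem bracket_map_right (T : Fock E₀ E₁ →L[ℂ] Fock E₀ E₁) (Ξ Θ : FockExt E₀ E₁) :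
    bracket Ξ (LExt.map T Θ) = bracket (LExt.map (Fock.transpose T) Ξ) Θ := by
  apply lp.ext; funext A
  refine Finset.sum_congr rfl fun B _ => ?_
  congr 1
  exact (Fock.pairing_transpose T (Ξ B) (Θ (A \ B))).symm

end Powers

/-! ## Real homogeneous vectors -/

section RealVectors

variable {E₀ E₁ : Type*} [NormedAddCommGroup E₀] [InnerProductSpace ℂ E₀] [CompleteSpace E₀]
  [NormedAddCommGroup E₁] [InnerProductSpace ℂ E₁] [CompleteSpace E₁]

/-- The basis vectors of `E ⊕ E*`. -/
def Doubled.basisVec {E : Type*} [NormedAddCommGroup E] [InnerProductSpace ℂ E]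
    [CompleteSpace E] : BasisIndex E × Bool → Doubled E
  | (i, false) => WithLp.toLp 2 (onb E i, 0)
  | (i, true) => WithLp.toLp 2 (0, InnerProductSpace.toDual ℂ E (onb E i))

theorem Doubled.coord_basisVec {E : Type*} [NormedAddCommGroup E] [InnerProductSpace ℂ E]
    [CompleteSpace E] [DecidableEq (BasisIndex E × Bool)] (k l : BasisIndex E × Bool) :
    (Doubled.basisVec k).coord l = if l = k then 1 else 0 := by
  classical
  have h := orthonormal_iff_ite.1 (onb E).orthonormal
  rcases k with ⟨i, _ | _⟩ <;> rcases l with ⟨j, _ | _⟩ <;>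
    simp [Doubled.basisVec, Doubled.coord, h, eq_comm]

theorem Doubled.star_basisVec {E : Type*} [NormedAddCommGroup E] [InnerProductSpace ℂ E]
    [CompleteSpace E] (k : BasisIndex E × Bool) :
    Doubled.star E (Doubled.basisVec k) = Doubled.basisVec (k.map id not) := by
  rcases k with ⟨i, _ | _⟩ <;> simp [Doubled.basisVec, Doubled.star]

/-- The basis vector of `H` with index `m`. -/
def OneP.basisVec : Mode E₀ E₁ → OneP E₀ E₁
  | .inl k => WithLp.toLp 2 (Doubled.basisVec k, 0)
  | .inr k => WithLp.toLp 2 (0, Doubled.basisVec k)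

theorem OneP.coord_basisVec [DecidableEq (Mode E₀ E₁)] (m l : Mode E₀ E₁) :
    (OneP.basisVec m).coord l = if l = m then 1 else 0 := by
  classical
  rcases m with k | k <;> rcases l with l | l <;>
    simp [OneP.basisVec, OneP.coord, Doubled.coord_basisVec, Doubled.coord_zero]

theorem OneP.star_basisVec (m : Mode E₀ E₁) :
    OneP.star E₀ E₁ (OneP.basisVec m) = OneP.basisVec m.bar := by
  rcases m with k | k <;>
    simp [OneP.basisVec, OneP.star, Doubled.star_basisVec, Mode.bar]

variable (E₀ E₁) in
/-- The real vectors of parity `b` in `H`. -/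
def realVectors (b : Bool) : Set (OneP E₀ E₁) :=
  {f | OneP.star E₀ E₁ f = f ∧ (b = false → f.snd = 0) ∧ (b = true → f.fst = 0)}

theorem smul_add_smul_bar_mem_realVectors (c : ℂ) (m : Mode E₀ E₁) :
    c • OneP.basisVec m + conj c • OneP.basisVec m.bar ∈ realVectors E₀ E₁ m.isOdd := by
  refine ⟨?_, ?_, ?_⟩
  · rw [map_add, map_smulₛₗ, map_smulₛₗ, OneP.star_basisVec, OneP.star_basisVec, Mode.bar_bar,
      Complex.conj_conj, add_comm]
  · rcases m with k | k
    · exact fun _ => (congrArg₂ (· + ·) (smul_zero (A := Doubled E₁) c)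
        (smul_zero (A := Doubled E₁) (conj c))).trans (add_zero _)
    · simp [Mode.isOdd]
  · rcases m with k | k
    · simp [Mode.isOdd]
    · exact fun _ => (congrArg₂ (· + ·) (smul_zero (A := Doubled E₀) c)
        (smul_zero (A := Doubled E₀) (conj c))).trans (add_zero _)

theorem basisVec_mem_span_realVectors (m : Mode E₀ E₁) :
    OneP.basisVec m ∈ Submodule.span ℂ (realVectors E₀ E₁ m.isOdd) := by
  have h1 := smul_add_smul_bar_mem_realVectors 1 m
  have h2 := smul_add_smul_bar_mem_realVectors Complex.I m
  -- The real vectors `e + e*` and `i e - i e*` recover `e` with coefficients `1/2` and `-i/2`.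
  have h3 : OneP.basisVec m =
      (2⁻¹ : ℂ) • ((1 : ℂ) • OneP.basisVec m + conj (1 : ℂ) • OneP.basisVec m.bar) +
      (-(2⁻¹ * Complex.I)) •
        (Complex.I • OneP.basisVec m + conj Complex.I • OneP.basisVec m.bar) := by
    simp only [map_one, Complex.conj_I, smul_add, smul_smul]
    rw [show -(2⁻¹ * Complex.I) * Complex.I = 2⁻¹ by
        linear_combination (-2⁻¹ : ℂ) * Complex.I_mul_I,
      show -(2⁻¹ * Complex.I) * -Complex.I = -2⁻¹ by
        linear_combination (2⁻¹ : ℂ) * Complex.I_mul_I]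
    module
  rw [h3]
  exact add_mem (Submodule.smul_mem _ _ (Submodule.subset_span h1))
    (Submodule.smul_mem _ _ (Submodule.subset_span h2))

end RealVectors

/-! ## Decomposable tensors -/

section Decomposable

variable {E₀ E₁ : Type*} [NormedAddCommGroup E₀] [InnerProductSpace ℂ E₀] [CompleteSpace E₀]
  [NormedAddCommGroup E₁] [InnerProductSpace ℂ E₁] [CompleteSpace E₁] {p : ℕ}

/-- The tensor `v 0 ⊗ ⋯ ⊗ v (p-1)`. -/
def Tens.prod : {p : ℕ} → (Fin p → OneP E₀ E₁) → Tens E₀ E₁ p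
  | 0, _ => Tens.one
  | p + 1, v => tensMul E₀ E₁ p 1 (Tens.prod (Fin.init v)) (Tens.ofOneP (v (Fin.last p)))

theorem Tens.prod_apply (v : Fin p → OneP E₀ E₁) (a : Fin p → Mode E₀ E₁) :
    Tens.prod v a = ∏ i, (v i).coord (a i) := by
  induction p with
  | zero =>
    have ha : a = fun i => i.elim0 := Subsingleton.elim _ _
    subst ha
    simp [Tens.prod, Tens.one]
  | succ p ih =>
    rw [Tens.prod, tensMul_apply, ih, Fin.prod_univ_castSucc]
    rfl

theorem Tens.prod_basisVec [DecidableEq (Mode E₀ E₁)] (a : Fin p → Mode E₀ E₁) :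
    Tens.prod (fun i => OneP.basisVec (a i)) = lp.single 2 a (1 : ℂ) := by
  apply lp.ext; funext b
  rw [Tens.prod_apply, lp.single_apply, Pi.single_apply]
  simp only [OneP.coord_basisVec]
  rw [Finset.prod_ite_zero]
  simp [funext_iff]

variable (E₀ E₁ p) in
/-- The tensor product of `p` vectors as a multilinear map. -/
def Tens.prodMultilinear : MultilinearMap ℂ (fun _ : Fin p => OneP E₀ E₁) (Tens E₀ E₁ p) where
  toFun := Tens.prod
  map_update_add' v i x y := by
    apply lp.ext; funext a
    rw [lp.coeFn_add, Pi.add_apply, Tens.prod_apply, Tens.prod_apply, Tens.prod_apply]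
    simp only [Fintype.prod_eq_mul_prod_compl i, Function.update_self, OneP.coord_add, add_mul]
    congr 2 <;>
    exact Finset.prod_congr rfl fun j hj => by
      have : j ≠ i := by simpa using hj
      simp [this]
  map_update_smul' v i c x := by
    apply lp.ext; funext a
    rw [lp.coeFn_smul, Pi.smul_apply, Tens.prod_apply, Tens.prod_apply, smul_eq_mul]
    simp only [Fintype.prod_eq_mul_prod_compl i, Function.update_self, OneP.coord_smul, mul_assoc]
    congr 2
    exact Finset.prod_congr rfl fun j hj => by
      have : j ≠ i := by simpa using hj
      simp [this]

/-- A multilinear map that vanishes on the products of given sets vanishes on their spans. -/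
theorem multilinearMap_eq_zero_of_mem_span {ι V W : Type*} [Finite ι] [AddCommGroup V] [Module ℂ V]
    [AddCommGroup W] [Module ℂ W] (g : MultilinearMap ℂ (fun _ : ι => V) W) (R : ι → Set V)
    (hg : ∀ v, (∀ i, v i ∈ R i) → g v = 0) (v : ι → V)
    (hv : ∀ i, v i ∈ Submodule.span ℂ (R i)) : g v = 0 := by
  classical
  have := Fintype.ofFinite ι
  have key : ∀ (s : Finset ι) (v : ι → V), (∀ i ∈ s, v i ∈ Submodule.span ℂ (R i)) →
      -- Induction on the set `s` of slots whose entries are only required to lie in the span; each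
      -- step frees one slot by linearity.
      (∀ i ∉ s, v i ∈ R i) → g v = 0 := by
    intro s
    induction s using Finset.induction_on with
    | empty => exact fun v _ h => hg v fun i => h i (by simp)
    | insert i s hi ih =>
      intro v h1 h2
      have h3 : ∀ x ∈ Submodule.span ℂ (R i), g (Function.update v i x) = 0 := by
        intro x hx
        induction hx using Submodule.span_induction with
        | mem x hx =>
          refine ih _ (fun j hj => ?_) (fun j hj => ?_)
          · have hji : j ≠ i := fun h => hi (h ▸ hj)
            rw [Function.update_of_ne hji]
            exact h1 j (Finset.mem_insert_of_mem hj)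
          · by_cases hji : j = i
            · subst hji
              rwa [Function.update_self]
            · rw [Function.update_of_ne hji]
              exact h2 j (by simp [hji, hj])
        | zero => exact g.map_update_zero v i
        | add x y _ _ hx hy => rw [g.map_update_add, hx, hy, add_zero]
        | smul c x _ hx => rw [g.map_update_smul, hx, smul_zero]
      rw [← Function.update_eq_self i v]
      exact h3 _ (h1 i (Finset.mem_insert_self i s))
  exact key Finset.univ v (fun i _ => hv i) (fun i hi => absurd (Finset.mem_univ i) hi)

/-- A graded symmetric tensor vanishes if it pairs to zero with the products of real homogeneous
vectors. -/
theorem eq_zero_of_inner_star_symm_prod (F : symTens E₀ E₁ p)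
    (h : ∀ (b : Fin p → Bool) (v : Fin p → OneP E₀ E₁), (∀ i, v i ∈ realVectors E₀ E₁ (b i)) →
      inner ℂ (Tens.star (symm E₀ E₁ p (Tens.prod v))) (F : Tens E₀ E₁ p) = 0) : F = 0 := by
  classical
  set L : Tens E₀ E₁ p →L[ℂ] ℂ :=
    ((innerSL ℂ).comp (Tens.star.comp (symm E₀ E₁ p))).flip (F : Tens E₀ E₁ p)
  have h1 : ∀ a : Fin p → Mode E₀ E₁, L (lp.single 2 a (1 : ℂ)) = 0 := by
    intro a
    rw [← Tens.prod_basisVec]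
    exact multilinearMap_eq_zero_of_mem_span
      (L.toLinearMap.compMultilinearMap (Tens.prodMultilinear E₀ E₁ p))
      (fun i => realVectors E₀ E₁ (a i).isOdd) (fun v hv => h _ v hv) _
      (fun i => basisVec_mem_span_realVectors (a i))
  have h2 : ∀ G, L G = 0 := by
    intro G
    -- A continuous functional is determined by its values on the basis tensors.
    have hs := (lp.hasSum_single (by norm_num) G).mapL L
    have hz : ∀ a, L (lp.single 2 a (G a)) = 0 := fun a => by
      rw [show (lp.single 2 a (G a) : Tens E₀ E₁ p) = G a • lp.single 2 a (1 : ℂ) by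
        rw [← lp.single_smul]; simp, map_smul, h1, smul_zero]
    simp only [hz] at hs
    exact hs.unique hasSum_zero
  have h3 : ∀ G, inner ℂ (symm E₀ E₁ p G) (F : Tens E₀ E₁ p) = 0 := by
    intro G
    -- Since `symm` commutes with the involution, inserting `Tens.star G` undoes the involution in
    -- `L`.
    have h4 : inner ℂ (Tens.star (symm E₀ E₁ p (Tens.star G))) (F : Tens E₀ E₁ p) = 0 :=
      h2 (Tens.star G)
    rw [symm_star] at h4
    convert h4 using 2
    apply lp.ext; funext a
    simp
  have h5 : ∀ G ∈ symTens E₀ E₁ p, inner ℂ G (F : Tens E₀ E₁ p) = 0 := by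
    intro G hG
    refine closure_minimal (t := {G | inner ℂ G (F : Tens E₀ E₁ p) = 0}) ?_ ?_ hG
    · rintro _ ⟨G, rfl⟩
      exact h3 G
    · exact isClosed_eq (by fun_prop) continuous_const
  exact Subtype.ext (inner_self_eq_zero.1 (h5 F F.2))

end Decomposable

/-! ## Injectivity of `Υ` -/

section SumTmul

variable {V : Type*} [NormedAddCommGroup V] {p : ℕ}

/-- Finite sets of prescribed cardinalities, disjoint from each other and from a given set. -/
theorem exists_disjoint_family (A : Finset ℕ) (k : Fin p → ℕ) :
    ∃ B : Fin p → Finset ℕ, Pairwise (Function.onFun Disjoint B) ∧ (∀ i, (B i).card = k i) ∧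
      ∀ i, Disjoint (B i) A := by
  -- `Nat.pair i` assigns to each `i` its own infinite set of naturals, and the shift by `A.sup id +
  -- 1` moves them all beyond `A`.
  have hinj : ∀ i : Fin p, Function.Injective fun x : ℕ => A.sup id + 1 + Nat.pair i x :=
    fun i x y h => (Nat.pair_eq_pair.1 (Nat.add_left_cancel h)).2
  refine ⟨fun i => (Finset.range (k i)).map ⟨_, hinj i⟩, ?_, ?_, ?_⟩
  · intro i j hij
    refine Finset.disjoint_left.2 fun x hx hx' => hij ?_
    obtain ⟨y, -, rfl⟩ := Finset.mem_map.1 hx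
    obtain ⟨z, -, hz⟩ := Finset.mem_map.1 hx'
    exact Fin.ext (Nat.pair_eq_pair.1 (Nat.add_left_cancel hz)).1.symm
  · simp
  · intro i
    refine Finset.disjoint_left.2 fun x hx hA => ?_
    obtain ⟨y, -, rfl⟩ := Finset.mem_map.1 hx
    have h : A.sup id + 1 + Nat.pair i y ≤ A.sup id := Finset.le_sup (f := id) hA
    omega

/-- The element `∑ i, e_{B i} ⊗ f i`. -/
def sumTmul (B : Fin p → Finset ℕ) (f : Fin p → V) : LExt V :=
  ⟨Function.extend B f 0, memlp_of_summable (summable_of_hasFiniteSupport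
    ((Set.finite_range B).subset fun C hC => by
      by_contra h
      refine hC ?_
      change ‖Function.extend B f 0 C‖ ^ 2 = 0
      rw [Function.extend_apply' f (0 : Finset ℕ → V) C h]
      simp))⟩

theorem sumTmul_apply {B : Fin p → Finset ℕ} (hB : Function.Injective B)
    (f : Fin p → V) (i : Fin p) : sumTmul B f (B i) = f i :=
  hB.extend_apply f 0 i

theorem sumTmul_apply_of_notMem {B : Fin p → Finset ℕ} (f : Fin p → V) {C : Finset ℕ}
    (hC : ¬ ∃ i, B i = C) : sumTmul B f C = 0 :=
  Function.extend_apply' f (0 : Finset ℕ → V) C hC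

end SumTmul

/-! ### Separation of tensors by nilpotent test elements -/

section Injectivity

variable {E₀ E₁ : Type*} [NormedAddCommGroup E₀] [InnerProductSpace ℂ E₀] [CompleteSpace E₀]
  [NormedAddCommGroup E₁] [InnerProductSpace ℂ E₁] [CompleteSpace E₁] {p : ℕ}

/-- The sizes 4 and 5 have the parities required for bosons and fermions. Moreover `4 choose 2 = 6`
and `5 choose 2 = 10` are even, so `e_B` is fixed by the involution and real vectors `f i` give a
real element. -/
theorem sumTmul_mem_superspaceD {B : Fin p → Finset ℕ} (hB : Function.Injective B)
    {b : Fin p → Bool} (hb : ∀ i, (B i).card = if b i then 5 else 4)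
    {f : Fin p → OneP E₀ E₁} (hf : ∀ i, f i ∈ realVectors E₀ E₁ (b i)) :
    sumTmul B f ∈ superspaceD E₀ E₁ := by
  constructor
  · intro C
    by_cases hC : ∃ i, B i = C
    · obtain ⟨i, rfl⟩ := hC
      rw [sumTmul_apply hB, hb]
      have h := (hf i).2
      cases hbi : b i
      · exact ⟨fun _ => h.1 hbi, fun h5 => absurd (by decide) h5⟩
      · exact ⟨fun h5 => absurd h5 (by decide), fun _ => h.2 hbi⟩
    · rw [sumTmul_apply_of_notMem f hC]
      exact ⟨fun _ => rfl, fun _ => rfl⟩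
  · apply lp.ext; funext C
    change (-1 : ℂ) ^ C.card.choose 2 • OneP.star E₀ E₁ (sumTmul B f C) = sumTmul B f C
    by_cases hC : ∃ i, B i = C
    · obtain ⟨i, rfl⟩ := hC
      rw [sumTmul_apply hB, hb, (hf i).1]
      cases b i <;> norm_num [Nat.choose]
    · rw [sumTmul_apply_of_notMem f hC, map_zero]
      exact smul_zero (A := OneP E₀ E₁) ((-1 : ℂ) ^ C.card.choose 2)

/-- Only the rearrangements of the sets `B i` contribute to the powers of `∑ i, e_{B i} ⊗ f i`. -/
theorem exists_comp_of_prod_ne_zero {q : ℕ} {B : Fin p → Finset ℕ} (hB : ∀ i, (B i).Nonempty)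
    (f : Fin p → OneP E₀ E₁) {C : Finset ℕ} {D : Fin q → Finset ℕ} (hD : D ∈ parts q C)
    {a : Fin q → Mode E₀ E₁} (h : ∏ i, (sumTmul B f (D i)).coord (a i) ≠ 0) :
    ∃ j : Fin q → Fin p, Function.Injective j ∧ D = B ∘ j := by
  have h1 : ∀ i, ∃ j, B j = D i := by
    intro i
    by_contra hi
    refine Finset.prod_ne_zero_iff.1 h i (Finset.mem_univ i) ?_
    rw [sumTmul_apply_of_notMem f hi]
    exact congrArg (fun F : Tens E₀ E₁ 1 => F fun _ => a i) (map_zero Tens.ofOneP)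
  choose j hj using h1
  refine ⟨j, fun i i' hii => ?_, funext fun i => (hj i).symm⟩
  by_contra hne
  have h2 : Disjoint (D i) (D i') := (mem_parts.1 hD).1 hne
  rw [← hj, ← hj, hii, Finset.disjoint_self_iff_empty] at h2
  exact (hB _).ne_empty h2

theorem injective_of_disjoint_nonempty {B : Fin p → Finset ℕ}
    (hd : Pairwise (Function.onFun Disjoint B)) (hB : ∀ i, (B i).Nonempty) :
    Function.Injective B := by
  intro i j hij
  by_contra hne
  have h : Disjoint (B i) (B j) := hd hne
  rw [hij, Finset.disjoint_self_iff_empty] at h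
  exact (hB j).ne_empty h

/-- Nilpotency: a nonzero term would use `q` different sets among the `p` available ones. -/
theorem tensPow_sumTmul_of_lt {q : ℕ} (hq : p < q) {B : Fin p → Finset ℕ}
    (hB : ∀ i, (B i).Nonempty) (f : Fin p → OneP E₀ E₁) (C : Finset ℕ)
    (a : Fin q → Mode E₀ E₁) : tensPow (sumTmul B f) q C a = 0 := by
  refine Finset.sum_eq_zero fun D hD => ?_
  by_contra h
  obtain ⟨j, hj, -⟩ := exists_comp_of_prod_ne_zero hB f hD (right_ne_zero_of_mul h)
  have := Fintype.card_le_of_injective j hj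
  simp at this
  omega

/-- With exactly `p` factors each `B i` is used once, so the union is forced. -/
theorem tensPow_sumTmul_of_ne {B : Fin p → Finset ℕ} (hB : ∀ i, (B i).Nonempty)
    (f : Fin p → OneP E₀ E₁) {C : Finset ℕ} (hC : C ≠ Finset.univ.biUnion B)
    (a : Fin p → Mode E₀ E₁) : tensPow (sumTmul B f) p C a = 0 := by
  refine Finset.sum_eq_zero fun D hD => ?_
  by_contra h
  obtain ⟨j, hj, rfl⟩ := exists_comp_of_prod_ne_zero hB f hD (right_ne_zero_of_mul h)
  have h1 : (B ∘ Equiv.ofBijective j (Finite.injective_iff_bijective.1 hj)) ∈ parts p C := hD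
  rw [comp_mem_parts_iff] at h1
  exact hC (mem_parts.1 h1).2.symm

/-- The contributing decompositions are the rearrangements `B ∘ σ`. Moving `σ` from the sets to the
modes produces the sign of the graded symmetrization, and the sum over `σ` is `p!` times the
average. -/
theorem tensPow_sumTmul_biUnion {B : Fin p → Finset ℕ}
    (hd : Pairwise (Function.onFun Disjoint B)) (hB : ∀ i, (B i).Nonempty)
    {f : Fin p → OneP E₀ E₁} (hf : sumTmul B f ∈ superspace E₀ E₁) (a : Fin p → Mode E₀ E₁) :
    tensPow (sumTmul B f) p (Finset.univ.biUnion B) a =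
      (p ! : ℂ) * partCoeff B * symm E₀ E₁ p (Tens.prod f) a := by
  classical
  have hinj := injective_of_disjoint_nonempty hd hB
  have h1 : tensPow (sumTmul B f) p (Finset.univ.biUnion B) a =
      ∑ σ : Equiv.Perm (Fin p), partCoeff (B ∘ σ) * ∏ i, (f (σ i)).coord (a i) := by
    have hi : Function.Injective fun σ : Equiv.Perm (Fin p) => B ∘ σ := fun σ τ h =>
      Equiv.ext fun i => hinj (congrFun h i)
    have hs : Finset.univ.image (fun σ : Equiv.Perm (Fin p) => B ∘ σ) ⊆
        parts p (Finset.univ.biUnion B) := by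
      intro D hD
      obtain ⟨σ, -, rfl⟩ := Finset.mem_image.1 hD
      exact (comp_mem_parts_iff σ).2 (mem_parts.2 ⟨hd, rfl⟩)
    rw [tensPow, ← Finset.sum_subset hs, Finset.sum_image hi.injOn]
    · refine Finset.sum_congr rfl fun σ _ => ?_
      simp only [Function.comp_apply, sumTmul_apply hinj]
    · intro D hD hD'
      by_contra h
      obtain ⟨j, hj, rfl⟩ := exists_comp_of_prod_ne_zero hB f hD (right_ne_zero_of_mul h)
      exact hD' (Finset.mem_image.2
        ⟨Equiv.ofBijective j (Finite.injective_iff_bijective.1 hj), Finset.mem_univ _, rfl⟩)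
  have h2 : ∀ σ : Equiv.Perm (Fin p), partCoeff (B ∘ σ) * ∏ i, (f (σ i)).coord (a i) =
      partCoeff B * (sgn σ⁻¹ a * Tens.prod f (a ∘ (σ⁻¹ : Equiv.Perm (Fin p)))) := by
    intro σ
    have h3 : ∏ i, (f (σ i)).coord (a i) = Tens.prod f (a ∘ (σ⁻¹ : Equiv.Perm (Fin p))) := by
      rw [Tens.prod_apply, ← Equiv.prod_comp σ fun i =>
        (f i).coord ((a ∘ (σ⁻¹ : Equiv.Perm (Fin p))) i)]
      simp
    rw [h3]
    by_cases h : Tens.prod f (a ∘ (σ⁻¹ : Equiv.Perm (Fin p))) = 0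
    · rw [h, mul_zero, mul_zero, mul_zero]
    · rw [Tens.prod_apply] at h
      rw [partCoeff_comp_perm_eq_sgn σ hd (a := a ∘ (σ⁻¹ : Equiv.Perm (Fin p))) fun i =>
        odd_card_iff_of_coord_ne_zero hf (by
          rw [sumTmul_apply hinj]
          exact Finset.prod_ne_zero_iff.1 h i (Finset.mem_univ i)),
        ← sgn_comp_inv σ⁻¹ a, inv_inv]
      ring
  have h4 : (p ! : ℂ) ≠ 0 := Nat.cast_ne_zero.2 (Nat.factorial_ne_zero _)
  have h5 : ∑ σ : Equiv.Perm (Fin p),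
      sgn σ⁻¹ a * Tens.prod f (a ∘ (σ⁻¹ : Equiv.Perm (Fin p))) =
      ∑ σ : Equiv.Perm (Fin p), sgn σ a * Tens.prod f (a ∘ σ) :=
    Equiv.sum_comp (Equiv.inv (Equiv.Perm (Fin p))) fun σ => sgn σ a * Tens.prod f (a ∘ σ)
  rw [h1, Finset.sum_congr rfl fun σ _ => h2 σ, ← Finset.mul_sum, h5, symm_apply]
  field_simp

/-- Evaluation at `C` and at degree `n` is continuous, and only the `n`-th term of the series has
degree `n`. -/
theorem superExp_apply (ζ : LExt (OneP E₀ E₁)) (C : Finset ℕ) (n : ℕ) :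
    superExp ζ C n = ((n ! : ℂ)⁻¹) • superPow ζ n C := by
  have h1 := ((summable_superExpTerm ζ).of_norm.hasSum.mapL
    (lp.evalCLM ℂ (fun _ : Finset ℕ => Fock E₀ E₁) 2 C)).mapL
    (lp.evalCLM ℂ (fun n : ℕ => symTens E₀ E₁ n) 2 n)
  have h2 : ∀ q, lp.evalCLM ℂ (fun n : ℕ => symTens E₀ E₁ n) 2 n
      (lp.evalCLM ℂ (fun _ : Finset ℕ => Fock E₀ E₁) 2 C (superExpTerm ζ q)) =
      ((q ! : ℂ)⁻¹) • (lp.single 2 q (superPow ζ q C) : Fock E₀ E₁) n := fun q => rfl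
  have h3 := hasSum_single (f := fun q => ((q ! : ℂ)⁻¹) •
    (lp.single 2 q (superPow ζ q C) : Fock E₀ E₁) n) n fun q hq => by
      rw [lp.single_apply_ne _ _ _ hq.symm, smul_zero]
  rw [lp.single_apply_self] at h3
  simp only [h2] at h1
  exact h1.unique h3

theorem symTens_ext_apply {F G : symTens E₀ E₁ p}
    (h : ∀ a, (F : Tens E₀ E₁ p) a = (G : Tens E₀ E₁ p) a) : F = G :=
  Subtype.ext (lp.ext (funext h))

/-- A tensor without components of degree less than `p` that pairs to zero with all coherent
states has no component of degree `p`. -/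
theorem apply_eq_zero_of_bracket_superExp {Ξ : FockExt E₀ E₁}
    (hΞ : ∀ ζ ∈ superspaceD E₀ E₁, bracket (superExp ζ) Ξ = 0) (p : ℕ)
    (hp : ∀ q < p, ∀ A, Ξ A q = 0) (A : Finset ℕ) : Ξ A p = 0 := by
  refine eq_zero_of_inner_star_symm_prod _ fun b f hf => ?_
  obtain ⟨B, hd, hc, hA⟩ := exists_disjoint_family A fun i => if b i then 5 else 4
  have hB : ∀ i, (B i).Nonempty := fun i => by
    rw [← Finset.card_pos, hc]
    split_ifs <;> norm_num
  have hinj := injective_of_disjoint_nonempty hd hB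
  have hζ := sumTmul_mem_superspaceD hinj hc hf
  set ζ := sumTmul B f
  set U := Finset.univ.biUnion B
  have hUA : Disjoint U A := (Finset.disjoint_biUnion_left _ _ _).2 fun i _ => hA i
  -- Only degree `p` survives: lower degrees vanish in `G`, higher ones in `exp ζ`.
  have h1 : ∀ C G, (∀ q < p, G q = 0) → Fock.pairing E₀ E₁ (superExp ζ C) G =
      inner ℂ (symStar E₀ E₁ p (((p ! : ℂ)⁻¹) • superPow ζ p C)) (G p) := by
    intro C G hG
    rw [Fock.pairing_apply, lp.inner_eq_tsum, tsum_eq_single p]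
    · rw [← superExp_apply]
      rfl
    · intro q hq
      rcases lt_or_gt_of_ne hq with hq | hq
      · rw [hG q hq, inner_zero_right]
      · have h2 : superExp ζ C q = 0 := by
          rw [superExp_apply, smul_eq_zero]
          right
          refine symTens_ext_apply fun a => ?_
          rw [superPow_apply hζ.1, tensPow_sumTmul_of_lt hq hB]
          simp
        change inner ℂ (symStar E₀ E₁ q (superExp ζ C q)) (G q) = 0
        rw [h2, map_zero, inner_zero_left]
  -- The coefficient at `U ∪ A` is a sum over splittings into `C` and its complement; only `C = U`
  -- contributes, which leaves `Ξ A` in the other slot.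
  have h3 : bracket (superExp ζ) Ξ (U ∪ A) = 0 := by
    rw [hΞ ζ hζ]
    rfl
  rw [bracket, ext₂_apply, Finset.sum_eq_single U] at h3
  · rw [Finset.union_sdiff_cancel_left hUA, h1 U (Ξ A) fun q hq => hp q hq A, smul_eq_mul] at h3
    have h4 : (mulCoeff U A : ℂ) ≠ 0 := by
      rw [Complex.ofReal_ne_zero, mulCoeff]
      exact mul_ne_zero (pow_ne_zero _ (by norm_num)) (by positivity)
    have h5 := (mul_eq_zero.1 h3).resolve_left h4
    -- On `U` the power is an explicit multiple of the symmetrized product; the scalar is nonzero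
    -- and is divided out at the end.
    have h6 : (superPow ζ p U : Tens E₀ E₁ p) =
        (((√(p ! : ℝ) : ℝ) : ℂ) * ((p ! : ℂ) * partCoeff B)) •
          symm E₀ E₁ p (Tens.prod f) := by
      apply lp.ext; funext a
      rw [superPow_apply hζ.1, tensPow_sumTmul_biUnion hd hB hζ.1, lp.coeFn_smul, Pi.smul_apply,
        smul_eq_mul]
      ring
    have h7 : (symStar E₀ E₁ p (((p ! : ℂ)⁻¹) • superPow ζ p U) : Tens E₀ E₁ p) =
        conj (((p ! : ℂ)⁻¹) * (((√(p ! : ℝ) : ℝ) : ℂ) * ((p ! : ℂ) * partCoeff B))) •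
          Tens.star (symm E₀ E₁ p (Tens.prod f)) := by
      rw [← map_smulₛₗ, mul_smul, ← h6]
      rfl
    rw [Submodule.coe_inner, h7, inner_smul_left, Complex.conj_conj] at h5
    refine (mul_eq_zero.1 h5).resolve_left ?_
    have h8 : (p ! : ℂ) ≠ 0 := Nat.cast_ne_zero.2 (Nat.factorial_ne_zero _)
    have h9 : ((√(p ! : ℝ) : ℝ) : ℂ) ≠ 0 := by
      rw [Complex.ofReal_ne_zero]
      positivity
    exact mul_ne_zero (inv_ne_zero h8) (mul_ne_zero h9 (mul_ne_zero h8 (partCoeff_ne_zero B)))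
  · intro C _ hC
    rw [h1 C _ fun q hq => hp q hq _]
    have h2 : superPow ζ p C = 0 := by
      refine symTens_ext_apply fun a => ?_
      rw [superPow_apply hζ.1, tensPow_sumTmul_of_ne hB f hC]
      simp
    rw [h2, smul_zero, map_zero, inner_zero_left, smul_zero]
  · intro h
    exact absurd (Finset.mem_powerset.2 Finset.subset_union_left) h

variable (E₀ E₁) in
-- Strong induction on the degree, for all Grassmann indices `A` at once, because the step for one
-- `A` uses the lower components at every index.
theorem toFun_injective : Function.Injective (toFun E₀ E₁) := by
  refine (injective_iff_map_eq_zero _).2 fun Ξ hΞ => ?_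
  have h1 : ∀ ζ ∈ superspaceD E₀ E₁, bracket (superExp ζ) Ξ = 0 := fun ζ hζ =>
    congrFun hΞ ⟨ζ, hζ⟩
  have h2 : ∀ p A, Ξ A p = 0 := by
    intro p
    induction p using Nat.strong_induction_on with
    | _ p ih => exact apply_eq_zero_of_bracket_superExp h1 p ih
  apply lp.ext; funext A
  apply lp.ext; funext p
  exact h2 p A

theorem tensorOf_phi (Ξ : FockExt E₀ E₁) : tensorOf (phi Ξ) = Ξ :=
  toFun_injective E₀ E₁ (Classical.choose_spec (phi Ξ).2)

end Injectivity

end SuperFock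

end

/-! ### The operator form, its kernel and the reproducing formula -/

theorem mainTheorem6 {E₀ E₁ : Type*}
    [NormedAddCommGroup E₀] [InnerProductSpace ℂ E₀] [CompleteSpace E₀]
    [NormedAddCommGroup E₁] [InnerProductSpace ℂ E₁] [CompleteSpace E₁]
    (T : SuperFock.Fock E₀ E₁ →L[ℂ] SuperFock.Fock E₀ E₁) :
    (∀ Ξ Θ : SuperFock.FockExt E₀ E₁,
      SuperFock.funPairing (SuperFock.phi Ξ) (SuperFock.phi Θ) = SuperFock.bracket Ξ Θ) ∧
    (∀ Ξ : SuperFock.FockExt E₀ E₁,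
      SuperFock.funOp T (SuperFock.phi Ξ) = SuperFock.phi (SuperFock.LExt.map T Ξ)) ∧
    (∀ ζ₁ ζ₂ : SuperFock.superspaceD E₀ E₁,
      SuperFock.opKernel T ζ₁ ζ₂ =
          SuperFock.bracket (SuperFock.superExp ζ₁.1)
            (SuperFock.LExt.map (SuperFock.Fock.transpose T) (SuperFock.superExp ζ₂.1)) ∧
        SuperFock.opKernel T ζ₁ ζ₂ =
          SuperFock.sesq (SuperFock.superExp ζ₁.1)
            (SuperFock.LExt.map (SuperFock.Fock.transpose T) (SuperFock.superExp ζ₂.1))) ∧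
    ∀ (f : SuperFock.funSpace E₀ E₁) (η : SuperFock.superspaceD E₀ E₁),
      ∃ hK : (fun ζ => SuperFock.opKernel T ζ η) ∈ SuperFock.funSpace E₀ E₁,
        (SuperFock.funOp T f).1 η = SuperFock.funPairing ⟨fun ζ => SuperFock.opKernel T ζ η, hK⟩ f := by
  have hP : ∀ Ξ Θ : SuperFock.FockExt E₀ E₁,
      SuperFock.funPairing (SuperFock.phi Ξ) (SuperFock.phi Θ) = SuperFock.bracket Ξ Θ := by
    intro Ξ Θ
    rw [SuperFock.funPairing, SuperFock.tensorOf_phi, SuperFock.tensorOf_phi]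
  refine ⟨hP, fun Ξ => ?_, fun ζ₁ ζ₂ => ⟨?_, ?_⟩, fun f η => ?_⟩
  · rw [SuperFock.funOp, SuperFock.tensorOf_phi]
  · exact SuperFock.bracket_map_left T _ _
  · rw [SuperFock.sesq, SuperFock.star_superExp ζ₁.2]
    exact SuperFock.bracket_map_left T _ _
  -- As a function of its first argument, the kernel is `φ_Θ` with `Θ = T' exp η`.
  · have hK : (fun ζ => SuperFock.opKernel T ζ η) = (SuperFock.phi (SuperFock.LExt.map
        (SuperFock.Fock.transpose T) (SuperFock.superExp η.1)) : SuperFock.funSpace E₀ E₁).1 :=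
      funext fun ζ => SuperFock.bracket_map_left T _ _
    have hm : (fun ζ => SuperFock.opKernel T ζ η) ∈ SuperFock.funSpace E₀ E₁ :=
      hK ▸ (SuperFock.phi _).2
    refine ⟨hm, ?_⟩
    have he : (⟨fun ζ => SuperFock.opKernel T ζ η, hm⟩ : SuperFock.funSpace E₀ E₁) =
        SuperFock.phi (SuperFock.LExt.map (SuperFock.Fock.transpose T)
          (SuperFock.superExp η.1)) := Subtype.ext hK
    -- With `f = φ_Ξ` the right side becomes `⟨T' exp η | Ξ⟩ = ⟨exp η | T Ξ⟩`, which is by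
    -- definition the value of `φ_{T Ξ}` at `η`.
    rw [he, ← SuperFock.phi_tensorOf f, hP, ← SuperFock.bracket_map_right,
      SuperFock.funOp, SuperFock.phi_tensorOf]
    rfl
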